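/- Let $\lambda\in\mathbb{C}$. Let $Q$ be the quiver with two vertices $R$ and $M$, two loops $a,b$ at $M$, one arrow $c\colon M\to R$ and one arrow $d\colon R\to M$. Paths are composed from right to left, so that $dc$ means "first $c$, then $d$". Let $A$ be the quotient of the path algebra $\mathbb{C}Q$ by the two-sided ideal generated by the relations $$(b^2+dc)d=0,\qquad c(b^2+dc)=0,\qquad ab+ba=0,\qquad a^2+bdc+dcb+\lambda b^2+b^3=0 .$$ For a vertex $v$ let $e_v\in A$ be the class of the trivial path at $v$, let $P_v=e_vA$ (the right $A$-module spanned by the classes of the paths ending at $v$), and let $L_v$ be the one-dimensional right $A$-module on which $e_v$ acts as the identity and the other trivial path and all arrows act as zero. Left multiplication by an element of $e_jAe_i$ is a homomorphism $P_i\to P_j$ of right $A$-modules. Consider the sequence of right $A$-modules $$0\to P_M\xrightarrow{\;f_2\;}P_R\oplus P_M^{\oplus2}\xrightarrow{\;f_1\;}P_R\oplus P_M^{\oplus2}\xrightarrow{\;f_0\;}P_M\xrightarrow{\;\varepsilon\;}L_M\to0,$$ where $$f_2=\begin{pmatrix}c\\a\\b\end{pmatrix},\qquad f_1=\begin{pmatrix}cd&0&cb\\0&b&a\\bd&a&dc+\lambda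 b+b^2\end{pmatrix},\qquad f_0=\begin{pmatrix}d&a&b\end{pmatrix},$$ and $\varepsilon$ is the canonical surjection, sending $e_M$ to $1$ and every path of positive length ending at $M$ to $0$. Then this sequence is a complex and is exact at every term, and $P_R$ and $P_M$ are projective, so that it is a projective resolution of the vertex simple $L_M$. Moreover, left multiplication by $b$ is injective on $P_M$. -/

import Mathlib

/-! ## The path algebra of a finite quiver -/

/-- A path of the quiver `V`, together with its source and its target. -/
structure QuiverPath (V : Type) [Quiver.{0} V] where
  /-- the vertex where the path begins -/
  src : V
  /-- the vertex where the path ends -/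
  tgt : V
  /-- the path itself -/
  path : Quiver.Path src tgt

/-- The path algebra: the `k`-vector space with basis the set of all paths of `V`. -/
def PathAlgebra (k V : Type) [Field k] [Quiver.{0} V] : Type := QuiverPath V →₀ k

noncomputable section

namespace PathAlgebra

variable {k V : Type} [Field k] [Quiver.{0} V]

instance : AddCommGroup (PathAlgebra k V) := inferInstanceAs (AddCommGroup (QuiverPath V →₀ k))

instance : Module k (PathAlgebra k V) := inferInstanceAs (Module k (QuiverPath V →₀ k))

variable (k) in
/-- The basis element of the path algebra given by a path. -/
def ofPath (p : QuiverPath V) : PathAlgebra k V := Finsupp.single p (1 : k)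

variable (k) in
/-- The trivial path at the vertex `v`. -/
def idem (v : V) : PathAlgebra k V := ofPath k ⟨v, v, Quiver.Path.nil⟩

variable (k) in
/-- The path of length one given by an arrow. -/
def ofArrow {i j : V} (f : i ⟶ j) : PathAlgebra k V := ofPath k ⟨i, j, f.toPath⟩

open Classical in
variable (k) in
/-- The product of two paths, composed from right to left: `p * q` is "first `q`, then `p`" if `q`
ends where `p` begins, and `0` otherwise. -/
def mulPath (p q : QuiverPath V) : PathAlgebra k V :=
  if h : q.tgt = p.src then ofPath k ⟨q.src, p.tgt, q.path.comp (p.path.cast h.symm rfl)⟩ else 0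

variable (k V) in
/-- The bilinear extension of the product of paths. -/
def mulBilin : PathAlgebra k V →ₗ[k] PathAlgebra k V →ₗ[k] PathAlgebra k V :=
  Finsupp.lift (PathAlgebra k V →ₗ[k] PathAlgebra k V) k (QuiverPath V) fun p =>
    Finsupp.lift (PathAlgebra k V) k (QuiverPath V) fun q => mulPath k p q

instance : Mul (PathAlgebra k V) := ⟨fun x y => mulBilin k V x y⟩

/-- The unit is the sum of all trivial paths. -/
instance [Fintype V] : One (PathAlgebra k V) := ⟨∑ v : V, idem k v⟩

theorem mul_def (x y : PathAlgebra k V) : x * y = mulBilin k V x y := rfl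

theorem one_def [Fintype V] : (1 : PathAlgebra k V) = ∑ v : V, idem k v := rfl

theorem ofPath_mul_ofPath (p q : QuiverPath V) : ofPath k p * ofPath k q = mulPath k p q := by
  rw [mul_def]
  have h : mulBilin k V (ofPath k p)
      = Finsupp.lift (PathAlgebra k V) k (QuiverPath V) fun q => mulPath k p q := by
    refine (Finsupp.lift_apply _ _ _ _ _).trans ?_
    refine (Finsupp.sum_single_index ?_).trans (one_smul k _)
    exact zero_smul k _
  rw [h]
  refine (Finsupp.lift_apply _ _ _ _ _).trans ?_
  refine (Finsupp.sum_single_index ?_).trans (one_smul k _)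
  exact zero_smul k _

theorem ofPath_mul_ofPath_comp {i j l : V} (p : Quiver.Path j l) (q : Quiver.Path i j) :
    ofPath k ⟨j, l, p⟩ * ofPath k ⟨i, j, q⟩ = ofPath k ⟨i, l, q.comp p⟩ := by
  rw [ofPath_mul_ofPath, mulPath, dif_pos rfl]
  rfl

theorem ofPath_mul_ofPath_ne {p q : QuiverPath V} (h : q.tgt ≠ p.src) :
    ofPath k p * ofPath k q = 0 := by
  rw [ofPath_mul_ofPath, mulPath, dif_neg h]

/-- Induction principle: the paths span the path algebra. -/
theorem induction_paths {motive : PathAlgebra k V → Prop} (x : PathAlgebra k V)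
    (zero : motive 0) (add : ∀ x y, motive x → motive y → motive (x + y))
    (smul_path : ∀ (r : k) (p : QuiverPath V), motive (r • ofPath k p)) : motive x := by
  refine Finsupp.induction_linear (motive := motive) x zero add fun p r => ?_
  have h : (Finsupp.single p r : QuiverPath V →₀ k) = r • Finsupp.single p (1 : k) := by simp
  rw [h]
  exact smul_path r p

theorem add_mul' (x y z : PathAlgebra k V) : (x + y) * z = x * z + y * z := by
  simp [mul_def]

theorem mul_add' (x y z : PathAlgebra k V) : x * (y + z) = x * y + x * z := by
  simp [mul_def]

theorem smul_mul' (r : k) (x y : PathAlgebra k V) : r • x * y = r • (x * y) := by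
  simp [mul_def]

theorem mul_smul' (r : k) (x y : PathAlgebra k V) : x * r • y = r • (x * y) := by
  simp [mul_def]

theorem zero_mul' (x : PathAlgebra k V) : 0 * x = 0 := by
  simp [mul_def]

theorem mul_zero' (x : PathAlgebra k V) : x * 0 = 0 := by
  simp [mul_def]

theorem ofPath_mul_assoc (p q r : QuiverPath V) :
    ofPath k p * ofPath k q * ofPath k r = ofPath k p * (ofPath k q * ofPath k r) := by
  obtain ⟨p₁, p₂, p⟩ := p
  obtain ⟨q₁, q₂, q⟩ := q
  obtain ⟨r₁, r₂, r⟩ := r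
  by_cases h : q₂ = p₁
  · subst h
    by_cases h' : r₂ = q₁
    · subst h'
      simp only [ofPath_mul_ofPath_comp, Quiver.Path.comp_assoc]
    · rw [ofPath_mul_ofPath_comp, ofPath_mul_ofPath_ne (p := ⟨q₁, _, _⟩) h',
        ofPath_mul_ofPath_ne (p := ⟨q₁, _, _⟩) h', mul_zero']
  · rw [ofPath_mul_ofPath_ne h, zero_mul']
    by_cases h' : r₂ = q₁
    · subst h'
      rw [ofPath_mul_ofPath_comp, ofPath_mul_ofPath_ne h]
    · rw [ofPath_mul_ofPath_ne (p := ⟨q₁, _, _⟩) h', mul_zero']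

theorem mul_assoc' (x y z : PathAlgebra k V) : x * y * z = x * (y * z) := by
  induction x using induction_paths with
  | zero => simp only [zero_mul']
  | add x x' hx hx' => simp only [add_mul', hx, hx']
  | smul_path r p =>
    induction y using induction_paths with
    | zero => simp only [zero_mul', mul_zero']
    | add y y' hy hy' => simp only [add_mul', mul_add', hy, hy']
    | smul_path s q =>
      induction z using induction_paths with
      | zero => simp only [mul_zero']
      | add z z' hz hz' => simp only [mul_add', hz, hz']
      | smul_path t u => simp only [smul_mul', mul_smul', ofPath_mul_assoc]

theorem finset_sum_mul' {ι : Type} (s : Finset ι) (f : ι → PathAlgebra k V)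
    (x : PathAlgebra k V) : (∑ i ∈ s, f i) * x = ∑ i ∈ s, f i * x := by
  simp [mul_def]

theorem mul_finset_sum' {ι : Type} (s : Finset ι) (f : ι → PathAlgebra k V)
    (x : PathAlgebra k V) : x * (∑ i ∈ s, f i) = ∑ i ∈ s, x * f i := by
  simp [mul_def]

theorem one_mul' [Fintype V] (x : PathAlgebra k V) : 1 * x = x := by
  induction x using induction_paths with
  | zero => simp only [mul_zero']
  | add x y hx hy => simp only [mul_add', hx, hy]
  | smul_path r p =>
    obtain ⟨i, j, p⟩ := p
    rw [mul_smul', one_def, finset_sum_mul', Finset.sum_eq_single j]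
    · rw [idem, ofPath_mul_ofPath_comp, Quiver.Path.comp_nil]
    · intro v _ hv
      exact ofPath_mul_ofPath_ne (Ne.symm hv)
    · intro h
      exact absurd (Finset.mem_univ j) h

theorem mul_one' [Fintype V] (x : PathAlgebra k V) : x * 1 = x := by
  induction x using induction_paths with
  | zero => simp only [zero_mul']
  | add x y hx hy => simp only [add_mul', hx, hy]
  | smul_path r p =>
    obtain ⟨i, j, p⟩ := p
    rw [smul_mul', one_def, mul_finset_sum', Finset.sum_eq_single i]
    · rw [idem, ofPath_mul_ofPath_comp, Quiver.Path.nil_comp]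
    · intro v _ hv
      exact ofPath_mul_ofPath_ne hv
    · intro h
      exact absurd (Finset.mem_univ i) h

instance [Fintype V] : Ring (PathAlgebra k V) :=
  { (inferInstance : AddCommGroup (PathAlgebra k V)) with
    mul := (· * ·)
    one := 1
    left_distrib := mul_add'
    right_distrib := add_mul'
    zero_mul := zero_mul'
    mul_zero := mul_zero'
    mul_assoc := mul_assoc'
    one_mul := one_mul'
    mul_one := mul_one' }

instance [Fintype V] : Algebra k (PathAlgebra k V) := Algebra.ofModule smul_mul' fun r x y =>
  mul_smul' r x y

/-- The coefficient of the trivial path at `v`, as a linear functional. -/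
def coeffIdem (v : V) : PathAlgebra k V →ₗ[k] k := Finsupp.lapply ⟨v, v, Quiver.Path.nil⟩

theorem coeffIdem_idem (v : V) : coeffIdem v (idem k v) = 1 := Finsupp.single_eq_same

theorem coeffIdem_ofPath_of_ne {v : V} {p : QuiverPath V} (h : p ≠ ⟨v, v, Quiver.Path.nil⟩) :
    coeffIdem v (ofPath k p) = 0 := Finsupp.single_eq_of_ne h.symm

theorem coeffIdem_ofArrow (v : V) {i j : V} (f : i ⟶ j) : coeffIdem v (ofArrow k f) = 0 := by
  refine coeffIdem_ofPath_of_ne fun h => ?_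
  rw [QuiverPath.mk.injEq] at h
  obtain ⟨rfl, rfl, h⟩ := h
  exact Quiver.Path.cons_ne_nil _ _ (eq_of_heq h)

theorem coeffIdem_mul (v : V) (x y : PathAlgebra k V) :
    coeffIdem v (x * y) = coeffIdem v x * coeffIdem v y := by
  induction x using induction_paths with
  | zero => simp only [zero_mul', map_zero, zero_mul]
  | add x x' hx hx' => simp only [add_mul', map_add, hx, hx', add_mul]
  | smul_path r p =>
    induction y using induction_paths with
    | zero => simp only [mul_zero', map_zero, mul_zero]
    | add y y' hy hy' => simp only [mul_add', map_add, hy, hy', mul_add]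
    | smul_path s q =>
      suffices h : coeffIdem v (ofPath k p * ofPath k q)
          = coeffIdem v (ofPath k p) * coeffIdem v (ofPath k q) by
        simp only [smul_mul', mul_smul', map_smul, h, smul_eq_mul]
        ring
      obtain ⟨p₁, p₂, p⟩ := p
      obtain ⟨q₁, q₂, q⟩ := q
      by_cases hpq : q₂ = p₁
      · subst hpq
        rw [ofPath_mul_ofPath_comp]
        cases p with
        | nil =>
          rw [Quiver.Path.comp_nil]
          by_cases hv : p₂ = v
          · subst hv
            change _ = coeffIdem p₂ (idem k p₂) * _
            rw [coeffIdem_idem, one_mul]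
          · rw [coeffIdem_ofPath_of_ne, coeffIdem_ofPath_of_ne, zero_mul]
            · intro h
              rw [QuiverPath.mk.injEq] at h
              exact hv h.1
            · intro h
              rw [QuiverPath.mk.injEq] at h
              exact hv h.2.1
        | cons p e =>
          rw [coeffIdem_ofPath_of_ne, coeffIdem_ofPath_of_ne, zero_mul]
          · intro h
            rw [QuiverPath.mk.injEq] at h
            obtain ⟨rfl, rfl, h⟩ := h
            exact Quiver.Path.cons_ne_nil _ _ (eq_of_heq h)
          · intro h
            rw [QuiverPath.mk.injEq] at h
            obtain ⟨rfl, rfl, h⟩ := h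
            exact Quiver.Path.cons_ne_nil _ _ (eq_of_heq h)
      · rw [ofPath_mul_ofPath_ne hpq, map_zero]
        by_cases hv : q₂ = v
        · rw [coeffIdem_ofPath_of_ne (p := ⟨p₁, _, _⟩), zero_mul]
          intro h
          rw [QuiverPath.mk.injEq] at h
          exact hpq (hv.trans h.1.symm)
        · rw [coeffIdem_ofPath_of_ne (p := ⟨q₁, _, _⟩), mul_zero]
          intro h
          rw [QuiverPath.mk.injEq] at h
          exact hv h.2.1

theorem coeffIdem_one [Fintype V] (v : V) : coeffIdem v (1 : PathAlgebra k V) = 1 := by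
  rw [one_def, map_sum, Finset.sum_eq_single v]
  · exact coeffIdem_idem v
  · intro w _ hw
    refine coeffIdem_ofPath_of_ne fun h => ?_
    rw [QuiverPath.mk.injEq] at h
    exact hw h.1
  · intro h
    exact absurd (Finset.mem_univ v) h

/-- The one-dimensional character of the path algebra at the vertex `v`: it sends the trivial path
at `v` to `1` and every other path to `0`. -/
def character [Fintype V] (v : V) : PathAlgebra k V →ₐ[k] k :=
  AlgHom.ofLinearMap (coeffIdem v) (coeffIdem_one v) (coeffIdem_mul v)

end PathAlgebra

/-! ## The Morrison–Pinkham quiver with its relations -/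

namespace MorrisonPinkham

/-- The two vertices of the quiver. -/
inductive Vertex : Type
  | R : Vertex
  | M : Vertex
  deriving DecidableEq

instance : Fintype Vertex where
  elems := {Vertex.R, Vertex.M}
  complete v := by cases v <;> simp

/-- The arrows: two loops `a`, `b` at `M`, one arrow `c` from `M` to `R` and one arrow `d` from `R`
to `M`. -/
inductive Arrow : Vertex → Vertex → Type
  | a : Arrow Vertex.M Vertex.M
  | b : Arrow Vertex.M Vertex.M
  | c : Arrow Vertex.M Vertex.R
  | d : Arrow Vertex.R Vertex.M

instance : Quiver Vertex := ⟨Arrow⟩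

/-- The complex path algebra of the quiver, before relations are imposed. -/
abbrev FreePaths : Type := PathAlgebra ℂ Vertex

/-- An arrow of the quiver as an element of the path algebra. -/
def arrow {i j : Vertex} (f : Arrow i j) : FreePaths := PathAlgebra.ofArrow ℂ (V := Vertex) f

/-- The relations, products of paths being read from right to left. -/
inductive Rel (lam : ℂ) : FreePaths → FreePaths → Prop
  | rel_c : Rel lam ((arrow .b ^ 2 + arrow .d * arrow .c) * arrow .d) 0
  | rel_d : Rel lam (arrow .c * (arrow .b ^ 2 + arrow .d * arrow .c)) 0
  | rel_a : Rel lam (arrow .a * arrow .b + arrow .b * arrow .a) 0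
  | rel_b : Rel lam (arrow .a ^ 2 + arrow .b * arrow .d * arrow .c
      + arrow .d * arrow .c * arrow .b + lam • arrow .b ^ 2 + arrow .b ^ 3) 0

/-- The Morrison–Pinkham algebra: the path algebra modulo the two-sided ideal generated by the
relations. -/
abbrev Alg (lam : ℂ) : Type := RingQuot (Rel lam)

section Elements

variable (lam : ℂ)

/-- The class of the trivial path at the vertex `v`. -/
def e (v : Vertex) : Alg lam := RingQuot.mkAlgHom ℂ (Rel lam) (PathAlgebra.idem ℂ v)

/-- The class of the arrow `a : M → M`. -/
def a : Alg lam := RingQuot.mkAlgHom ℂ (Rel lam) (arrow .a)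

/-- The class of the arrow `b : M → M`. -/
def b : Alg lam := RingQuot.mkAlgHom ℂ (Rel lam) (arrow .b)

/-- The class of the arrow `c : M → R`. -/
def c : Alg lam := RingQuot.mkAlgHom ℂ (Rel lam) (arrow .c)

/-- The class of the arrow `d : R → M`. -/
def d : Alg lam := RingQuot.mkAlgHom ℂ (Rel lam) (arrow .d)

theorem e_mul_arrow {i j : Vertex} (f : Arrow i j) :
    e lam j * RingQuot.mkAlgHom ℂ (Rel lam) (arrow f)
      = RingQuot.mkAlgHom ℂ (Rel lam) (arrow f) := by
  rw [e, ← map_mul]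
  exact congrArg _ (PathAlgebra.ofPath_mul_ofPath_comp _ _)

theorem e_mul_a : e lam .M * a lam = a lam := e_mul_arrow lam .a

theorem e_mul_b : e lam .M * b lam = b lam := e_mul_arrow lam .b

theorem e_mul_c : e lam .R * c lam = c lam := e_mul_arrow lam .c

theorem e_mul_d : e lam .M * d lam = d lam := e_mul_arrow lam .d

end Elements

/-! ## Projective right modules and the vertex simples

Right modules over `Alg lam` are modules over `(Alg lam)ᵐᵒᵖ`. -/

section Modules

variable (lam : ℂ)

/-- Left multiplication by `x`, as an endomorphism of the right regular module. -/
def leftMul (x : Alg lam) : Alg lam →ₗ[(Alg lam)ᵐᵒᵖ] Alg lam where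
  toFun y := x * y
  map_add' y z := mul_add x y z
  map_smul' r y := (mul_assoc x y r.unop).symm

/-- The right ideal `e_v A`, spanned by the paths that end at `v`. -/
def P (v : Vertex) : Submodule (Alg lam)ᵐᵒᵖ (Alg lam) := LinearMap.range (leftMul lam (e lam v))

variable {lam} in
theorem mul_mem_P {v : Vertex} {x : Alg lam} (hx : e lam v * x = x) (y : Alg lam) :
    x * y ∈ P lam v :=
  ⟨x * y, by change e lam v * (x * y) = x * y; rw [← mul_assoc, hx]⟩

/-- Left multiplication by an element `x` of `e_j A` as a homomorphism of right modules
`e_i A → e_j A`. -/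
def mulMap (i j : Vertex) (x : Alg lam) (hx : e lam j * x = x) :
    P lam i →ₗ[(Alg lam)ᵐᵒᵖ] P lam j :=
  (leftMul lam x).restrict fun y _ => mul_mem_P hx y

/-- The character of the Morrison–Pinkham algebra at the vertex `v`: it sends the trivial path at
`v` to `1`, and the other trivial path and all arrows to `0`. -/
def character (v : Vertex) : Alg lam →ₐ[ℂ] ℂ :=
  RingQuot.liftAlgHom ℂ ⟨PathAlgebra.character v, by
    have h : ∀ {i j : Vertex} (f : Arrow i j),
        PathAlgebra.character (k := ℂ) v (arrow f) = 0 := fun f =>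
      PathAlgebra.coeffIdem_ofArrow (V := Vertex) v f
    intro x y hxy
    cases hxy <;> simp [h]⟩

/-- The vertex simple `L_v`: the one-dimensional representation at the vertex `v`. -/
def VertexSimple (_ : ℂ) (_ : Vertex) : Type := ℂ

instance (v : Vertex) : AddCommGroup (VertexSimple lam v) := inferInstanceAs (AddCommGroup ℂ)

/-- An element `x` of the algebra acts on `L_v` from the right through the character at `v`. -/
instance (v : Vertex) : Module (Alg lam)ᵐᵒᵖ (VertexSimple lam v) where
  smul r z := (show ℂ from z) * character lam v r.unop
  one_smul z := by
    change (show ℂ from z) * character lam v 1 = z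
    rw [map_one, mul_one]
  mul_smul r s z := by
    change (show ℂ from z) * character lam v (s.unop * r.unop)
      = (show ℂ from z) * character lam v s.unop * character lam v r.unop
    rw [map_mul, mul_assoc]
  smul_zero r := zero_mul (character lam v r.unop)
  smul_add r y z := add_mul (show ℂ from y) (show ℂ from z) (character lam v r.unop)
  add_smul r s z := by
    change (show ℂ from z) * character lam v (r.unop + s.unop)
      = (show ℂ from z) * character lam v r.unop + (show ℂ from z) * character lam v s.unop
    rw [map_add, mul_add]
  zero_smul z := by
    change (show ℂ from z) * character lam v 0 = 0
    rw [map_zero, mul_zero]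

/-- The canonical surjection `e_v A → L_v`: the class of the trivial path goes to `1`, the classes
of all longer paths go to `0`. -/
def augmentation (v : Vertex) : P lam v →ₗ[(Alg lam)ᵐᵒᵖ] VertexSimple lam v where
  toFun y := character lam v (y : Alg lam)
  map_add' y z := map_add (character lam v) (y : Alg lam) (z : Alg lam)
  map_smul' r y := map_mul (character lam v) (y : Alg lam) r.unop

end Modules

/-! ## The complex -/

section Complex

variable (lam : ℂ)

/-- The matrix `(c, a, b)ᵀ`. -/
def f₂ : P lam .M →ₗ[(Alg lam)ᵐᵒᵖ] P lam .R × P lam .M × P lam .M :=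
  (mulMap lam .M .R (c lam) (e_mul_c lam)).prod
    ((mulMap lam .M .M (a lam) (e_mul_a lam)).prod (mulMap lam .M .M (b lam) (e_mul_b lam)))

/-- The matrix with rows `(c d, 0, c b)`, `(0, b, a)` and `(b d, a, d c + λ b + b²)`. -/
def f₁ : P lam .R × P lam .M × P lam .M →ₗ[(Alg lam)ᵐᵒᵖ] P lam .R × P lam .M × P lam .M :=
  LinearMap.prod
    (LinearMap.coprod
      (mulMap lam .R .R (c lam * d lam) (by rw [← mul_assoc, e_mul_c]))
      (LinearMap.coprod
        0
        (mulMap lam .M .R (c lam * b lam) (by rw [← mul_assoc, e_mul_c]))))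
    (LinearMap.prod
      (LinearMap.coprod
        0
        (LinearMap.coprod
          (mulMap lam .M .M (b lam) (e_mul_b lam))
          (mulMap lam .M .M (a lam) (e_mul_a lam))))
      (LinearMap.coprod
        (mulMap lam .R .M (b lam * d lam) (by rw [← mul_assoc, e_mul_b]))
        (LinearMap.coprod
          (mulMap lam .M .M (a lam) (e_mul_a lam))
          (mulMap lam .M .M (d lam * c lam + lam • b lam + b lam ^ 2) (by
            rw [mul_add, mul_add, mul_smul_comm, pow_two, ← mul_assoc, ← mul_assoc, e_mul_d,
              e_mul_b])))))

/-- The matrix `(d, a, b)`. -/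
def f₀ : P lam .R × P lam .M × P lam .M →ₗ[(Alg lam)ᵐᵒᵖ] P lam .M :=
  (mulMap lam .R .M (d lam) (e_mul_d lam)).coprod
    ((mulMap lam .M .M (a lam) (e_mul_a lam)).coprod (mulMap lam .M .M (b lam) (e_mul_b lam)))

end Complex

end MorrisonPinkham

end

/-!
The elements `z = b² - c d`, `w = d c b + b d c + b³ + c b d` and `y = d c a + a d c + b² a + c a d`
are central, and over `ℂ[z, w, y]` the elements `e_M`, `b`, `a`, `b a` multiply like the quaternion
units `1`, `i`, `j`, `k` with `i² = z` and `j² = -w - lam z`. Moving `d c` past such a quaternion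
costs only a twist and a derivation, so every element of `e_M A` has the form `h₀ + h₁ d c + h₂ d`,
and every element of `e_R A` the form `c h + r e_R + s c b a d`. These forms are unique, because `A`
acts on the free `ℂ[z, w, y]`-module of all of them.

In these coordinates, `b` is left cancellable on `e_M A` and `d` on `e_R A`; if `a x ∈ b A` with
`x ∈ e_M A`, then `x ∈ b A`; and if `d x ∈ a A + b A` with `x ∈ e_R A`, then
`x ∈ c d A + c b A`. The kernels of the matrices are computed from these four facts by clearing one
entry at a time.
-/

noncomputable section

namespace PathAlgebra

variable {k V : Type} [Field k] [Quiver.{0} V]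

theorem induction_arrow_mul {motive : PathAlgebra k V → Prop} (zero : motive 0)
    (add : ∀ x y, motive x → motive y → motive (x + y))
    (smul : ∀ (r : k) x, motive x → motive (r • x)) (idem : ∀ v, motive (idem k v))
    (arrow_mul : ∀ {i j : V} (f : i ⟶ j) x, motive x → motive (ofArrow k f * x))
    (x : PathAlgebra k V) : motive x := by
  induction x using induction_paths with
  | zero => exact zero
  | add x y hx hy => exact add x y hx hy
  | smul_path r p =>
    obtain ⟨i, j, p⟩ := p
    refine smul r _ ?_
    induction p with
    | nil => exact idem i
    | cons p f ih =>
      have h := arrow_mul f _ ih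
      rwa [ofArrow, ofPath_mul_ofPath_comp] at h

variable {E : Type*} [Ring E] [Algebra k E]

/-- The elements `ε v` and `g f` of a ring satisfy the rules for multiplying the trivial paths and
the arrows of a quiver. -/
structure IsRepresentation [Fintype V] (ε : V → E) (g : ∀ {i j : V}, (i ⟶ j) → E) : Prop extends
    CompleteOrthogonalIdempotents ε where
  idem_mul_arrow : ∀ {i j : V} (f : i ⟶ j), ε j * g f = g f
  arrow_mul_idem : ∀ {i j : V} (f : i ⟶ j), g f * ε i = g f

/-- The image of a path when the trivial paths go to `ε` and the arrows to `g`. -/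
def evalPath (ε : V → E) (g : ∀ {i j : V}, (i ⟶ j) → E) {i : V} :
    ∀ {j : V}, Quiver.Path i j → E
  | _, .nil => ε i
  | _, .cons p f => g f * evalPath ε g p

variable (k) in
/-- The linear extension of `evalPath` to the path algebra. -/
def evalLinear (ε : V → E) (g : ∀ {i j : V}, (i ⟶ j) → E) : PathAlgebra k V →ₗ[k] E :=
  Finsupp.lift E k (QuiverPath V) fun p => evalPath ε g p.path

theorem evalLinear_ofPath (ε : V → E) (g : ∀ {i j : V}, (i ⟶ j) → E) (p : QuiverPath V) :
    evalLinear k ε g (ofPath k p) = evalPath ε g p.path := by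
  refine (Finsupp.lift_apply _ _ _ _ _).trans ((Finsupp.sum_single_index ?_).trans (one_smul k _))
  exact zero_smul k _

namespace IsRepresentation

variable [Fintype V] {ε : V → E} {g : ∀ {i j : V}, (i ⟶ j) → E}

theorem evalPath_mul_idem (h : IsRepresentation ε g) {i j : V} (p : Quiver.Path i j) :
    evalPath ε g p * ε i = evalPath ε g p := by
  induction p with
  | nil => exact h.idem i
  | cons p f ih => rw [evalPath, mul_assoc, ih]

theorem idem_mul_evalPath (h : IsRepresentation ε g) {i j : V} (p : Quiver.Path i j) :
    ε j * evalPath ε g p = evalPath ε g p := by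
  cases p with
  | nil => exact h.idem i
  | cons p f => rw [evalPath, ← mul_assoc, h.idem_mul_arrow]

theorem evalPath_comp (h : IsRepresentation ε g) {i j l : V} (q : Quiver.Path i j)
    (p : Quiver.Path j l) : evalPath ε g (q.comp p) = evalPath ε g p * evalPath ε g q := by
  induction p with
  | nil => rw [Quiver.Path.comp_nil, evalPath, h.idem_mul_evalPath]
  | cons p f ih => rw [Quiver.Path.comp_cons, evalPath, evalPath, ih, mul_assoc]

theorem evalPath_mul_evalPath_of_ne (h : IsRepresentation ε g) {i j l m : V}
    (p : Quiver.Path l m) (q : Quiver.Path i j) (hne : j ≠ l) :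
    evalPath ε g p * evalPath ε g q = 0 := by
  rw [← h.evalPath_mul_idem p, ← h.idem_mul_evalPath q, mul_assoc, ← mul_assoc (ε l),
    h.ortho hne.symm, zero_mul, mul_zero]

theorem evalLinear_ofPath_mul_ofPath (h : IsRepresentation ε g) (p q : QuiverPath V) :
    evalLinear k ε g (ofPath k p * ofPath k q)
      = evalLinear k ε g (ofPath k p) * evalLinear k ε g (ofPath k q) := by
  obtain ⟨p₁, p₂, p⟩ := p
  obtain ⟨q₁, q₂, q⟩ := q
  by_cases hpq : q₂ = p₁
  · subst hpq
    simp only [ofPath_mul_ofPath_comp, evalLinear_ofPath, h.evalPath_comp]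
  · rw [ofPath_mul_ofPath_ne hpq, map_zero, evalLinear_ofPath, evalLinear_ofPath,
      h.evalPath_mul_evalPath_of_ne p q hpq]

theorem evalLinear_mul (h : IsRepresentation ε g) (x y : PathAlgebra k V) :
    evalLinear k ε g (x * y) = evalLinear k ε g x * evalLinear k ε g y := by
  induction x using induction_paths with
  | zero => simp only [zero_mul, map_zero]
  | add x x' hx hx' => simp only [add_mul, map_add, hx, hx']
  | smul_path r p =>
    induction y using induction_paths with
    | zero => simp only [mul_zero, map_zero]
    | add y y' hy hy' => simp only [mul_add, map_add, hy, hy']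
    | smul_path s q =>
      simp only [smul_mul_assoc, mul_smul_comm, map_smul, h.evalLinear_ofPath_mul_ofPath]

theorem evalLinear_one (h : IsRepresentation ε g) : evalLinear k ε g 1 = 1 := by
  rw [one_def, map_sum, ← h.complete]
  exact Finset.sum_congr rfl fun v _ => evalLinear_ofPath ε g _

variable (k) in
/-- The universal property of the path algebra. -/
def lift (h : IsRepresentation ε g) : PathAlgebra k V →ₐ[k] E :=
  AlgHom.ofLinearMap (evalLinear k ε g) h.evalLinear_one h.evalLinear_mul

theorem lift_idem (h : IsRepresentation ε g) (v : V) : h.lift k (PathAlgebra.idem k v) = ε v :=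
  evalLinear_ofPath ε g _

theorem lift_ofArrow (h : IsRepresentation ε g) {i j : V} (f : i ⟶ j) :
    h.lift k (ofArrow k f) = g f :=
  (evalLinear_ofPath ε g _).trans (h.arrow_mul_idem f)

end IsRepresentation

end PathAlgebra

namespace MorrisonPinkham

variable {lam : ℂ}

theorem Alg.induction {motive : Alg lam → Prop} (add : ∀ x y, motive x → motive y → motive (x + y))
    (smul : ∀ (r : ℂ) x, motive x → motive (r • x)) (idem : ∀ v, motive (e lam v))
    (a_mul : ∀ x, motive x → motive (a lam * x)) (b_mul : ∀ x, motive x → motive (b lam * x))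
    (c_mul : ∀ x, motive x → motive (c lam * x)) (d_mul : ∀ x, motive x → motive (d lam * x))
    (x : Alg lam) : motive x := by
  obtain ⟨x, rfl⟩ := RingQuot.mkAlgHom_surjective ℂ (Rel lam) x
  induction x using PathAlgebra.induction_arrow_mul with
  | zero => simpa using smul 0 _ (idem .M)
  | add x y hx hy => simpa only [map_add] using add _ _ hx hy
  | smul r x hx => simpa only [map_smul] using smul r _ hx
  | idem v => exact idem v
  | arrow_mul f x hx =>
    rw [map_mul]
    rcases f with _ | _ | _ | _
    · exact a_mul _ hx
    · exact b_mul _ hx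
    · exact c_mul _ hx
    · exact d_mul _ hx

/-- The universal property of the Morrison–Pinkham algebra. -/
def Alg.lift {E : Type*} [Ring E] [Algebra ℂ E] {ε : Vertex → E}
    {g : ∀ {i j : Vertex}, (i ⟶ j) → E} (h : PathAlgebra.IsRepresentation ε g)
    (hc : (g Arrow.b ^ 2 + g Arrow.d * g Arrow.c) * g Arrow.d = 0)
    (hd : g Arrow.c * (g Arrow.b ^ 2 + g Arrow.d * g Arrow.c) = 0)
    (ha : g Arrow.a * g Arrow.b + g Arrow.b * g Arrow.a = 0)
    (hb : g Arrow.a ^ 2 + g Arrow.b * g Arrow.d * g Arrow.c + g Arrow.d * g Arrow.c * g Arrow.b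
      + lam • g Arrow.b ^ 2 + g Arrow.b ^ 3 = 0) : Alg lam →ₐ[ℂ] E :=
  RingQuot.liftAlgHom ℂ ⟨h.lift ℂ, fun x y hxy => by
    have hf {i j : Vertex} (f : Arrow i j) : h.lift ℂ (arrow f) = g (i := i) (j := j) f :=
      h.lift_ofArrow _
    cases hxy <;> simpa only [map_add, map_mul, map_pow, map_smul, map_zero, hf]⟩

section Relations

variable (lam)

theorem e_mul_e_self (v : Vertex) : e lam v * e lam v = e lam v := by
  rw [e, ← map_mul]
  exact congrArg _ (PathAlgebra.ofPath_mul_ofPath_comp _ _)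

theorem e_mul_e_of_ne {v w : Vertex} (h : v ≠ w) : e lam v * e lam w = 0 := by
  rw [e, e, ← map_mul, ← map_zero (RingQuot.mkAlgHom ℂ (Rel lam))]
  exact congrArg _ (PathAlgebra.ofPath_mul_ofPath_ne h.symm)

theorem one_eq_e_add_e : (1 : Alg lam) = e lam .M + e lam .R := by
  rw [← map_one (RingQuot.mkAlgHom ℂ (Rel lam)), PathAlgebra.one_def, map_sum, add_comm]
  exact Finset.sum_pair (by decide)

theorem arrow_mul_e {i j : Vertex} (f : Arrow i j) :
    RingQuot.mkAlgHom ℂ (Rel lam) (arrow f) * e lam i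
      = RingQuot.mkAlgHom ℂ (Rel lam) (arrow f) := by
  rw [e, ← map_mul]
  exact congrArg _ (PathAlgebra.ofPath_mul_ofPath_comp _ _)

theorem a_mul_e : a lam * e lam .M = a lam := arrow_mul_e lam .a

theorem b_mul_e : b lam * e lam .M = b lam := arrow_mul_e lam .b

theorem c_mul_e : c lam * e lam .M = c lam := arrow_mul_e lam .c

theorem d_mul_e : d lam * e lam .R = d lam := arrow_mul_e lam .d

variable {lam} in
theorem mul_eq_zero_of_ne {v w : Vertex} {x y : Alg lam} (hx : x * e lam v = x)
    (hy : e lam w * y = y) (h : v ≠ w) : x * y = 0 := by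
  rw [← hx, ← hy, mul_assoc, ← mul_assoc (e lam v), e_mul_e_of_ne lam h, zero_mul, mul_zero]

theorem relation_d : b lam * b lam * d lam + d lam * c lam * d lam = 0 := by
  have h := RingQuot.mkAlgHom_rel ℂ (Rel.rel_c (lam := lam))
  simp only [map_mul, map_add, map_zero, pow_two, add_mul] at h
  exact h

theorem relation_c : c lam * (b lam * b lam) + c lam * (d lam * c lam) = 0 := by
  have h := RingQuot.mkAlgHom_rel ℂ (Rel.rel_d (lam := lam))
  simp only [map_mul, map_add, map_zero, pow_two, mul_add] at h
  exact h

theorem relation_ab : a lam * b lam + b lam * a lam = 0 := by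
  have h := RingQuot.mkAlgHom_rel ℂ (Rel.rel_a (lam := lam))
  simp only [map_mul, map_add, map_zero] at h
  exact h

theorem relation_a_sq : a lam * a lam + b lam * (d lam * c lam) + d lam * c lam * b lam
    + algebraMap ℂ (Alg lam) lam * (b lam * b lam) + b lam * b lam * b lam = 0 := by
  have h := RingQuot.mkAlgHom_rel ℂ (Rel.rel_b (lam := lam))
  simp only [map_mul, map_add, map_pow, map_zero, map_smul] at h
  rw [← Algebra.smul_def, ← pow_two, ← pow_two, ← pow_succ, ← mul_assoc]
  exact h

end Relations

section Clifford

variable {A : Type*} [Ring A] {a b c d l t x : A}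

/-- The polarization of the squaring map at `x` and `t + b ^ 2 / 2`, for `x` commuting with
`b ^ 2`. With `t = d c`, its values at `x = b` and `x = a` are the components at `M` of the central
elements `w` and `y`. -/
def polar (b t x : A) : A := t * x + x * t + b * b * x

theorem commute_a_b_sq (hab : a * b + b * a = 0) : Commute a (b * b) := by
  rw [commute_iff_eq]
  linear_combination (norm := noncomm_ring) hab * b - b * hab

theorem commute_b_sq_mul (hd : b * b * d + d * c * d = 0) (hc : c * (b * b) + c * (d * c) = 0) :
    Commute (b * b) (d * c) := by
  rw [commute_iff_eq]
  linear_combination (norm := noncomm_ring) hd * c - d * hc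

theorem commute_a_polar_b (hl : Commute l a) (hab : a * b + b * a = 0)
    (ha : a * a + b * t + t * b + l * (b * b) + b * b * b = 0) : Commute a (polar b t b) := by
  rw [commute_iff_eq, polar]
  linear_combination (norm := noncomm_ring)
    a * ha - ha * a - l * (commute_a_b_sq hab).eq + hl.eq * (b * b)

theorem commute_b_polar_b (ht : Commute (b * b) t) : Commute b (polar b t b) := by
  rw [commute_iff_eq, polar]
  linear_combination (norm := noncomm_ring) ht.eq

theorem commute_a_polar_a (hl : Commute l t) (ht : Commute (b * b) t)
    (ht' : t * t + b * b * t = 0) (hab : a * b + b * a = 0)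
    (ha : a * a + b * t + t * b + l * (b * b) + b * b * b = 0) : Commute a (polar b t a) := by
  rw [commute_iff_eq, polar]
  linear_combination (norm := noncomm_ring) (commute_a_b_sq hab).eq * a + ha * t - t * ha
    - b * ht' + ht' * b - l * ht.eq - hl.eq * (b * b) - ht.eq * b

-- The graded Jacobi identity for `a`, `b` and `t`, in which the anticommutator of `a` and `b` is 0.
theorem commute_b_polar_a (hl : Commute l a) (hab : a * b + b * a = 0)
    (ha : a * a + b * t + t * b + l * (b * b) + b * b * b = 0) : Commute b (polar b t a) := by
  have h := (commute_a_polar_b hl hab ha).eq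
  rw [polar] at h
  rw [commute_iff_eq, polar]
  linear_combination (norm := noncomm_ring) hab * t - t * hab + hab * b * b - b * hab * b
    - h

theorem mul_polar (hc : c * (b * b) + c * t = 0) : c * polar b t x = c * (x * t) := by
  rw [polar]
  linear_combination (norm := noncomm_ring) hc * x

theorem polar_mul (hd : b * b * d + t * d = 0) (hx : Commute x (b * b)) :
    polar b t x * d = t * (x * d) := by
  rw [polar]
  linear_combination (norm := noncomm_ring) x * hd - hx.eq * d

theorem mul_eq_polar_sub : t * x = polar b t x - b * b * x - x * t := by
  rw [polar]
  abel

theorem mul_b_mul_a_eq (hl : Commute l a) (hab : a * b + b * a = 0)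
    (ha : a * a + b * t + t * b + l * (b * b) + b * b * b = 0) :
    t * (b * a) = polar b t b * a - polar b t a * b + b * (a * t) := by
  linear_combination (norm := (simp only [polar]; noncomm_ring))
    -(commute_b_polar_a hl hab ha).eq

end Clifford

/-! ## A quaternionic model of the right modules `e_M A` and `e_R A` -/

section Model

open scoped Quaternion

variable {S : Type*} [CommRing S] (z : S) {q : S} (w y : S)

/-- The twist `σ` in the commutation rule `(d c) h = δ h + (σ h) (d c)` for a combination `h` of
`e_M`, `b`, `a` and `b a`. -/
def twist : ℍ[S,z,q] →ₗ[S] ℍ[S,z,q] where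
  toFun h := ⟨h.re, -h.imI, -h.imJ, h.imK⟩
  map_add' g h := by ext <;> simp <;> ring
  map_smul' r h := by ext <;> simp

/-- The `σ`-derivation `δ` in the commutation rule `(d c) h = δ h + (σ h) (d c)`; it is determined
by `δ b = w - z b` and `δ a = y - z a`. -/
def twistedDerivation : ℍ[S,z,q] →ₗ[S] ℍ[S,z,q] where
  toFun h := ⟨w * h.imI + y * h.imJ, -(z * h.imI) - y * h.imK, -(z * h.imJ) + w * h.imK, 0⟩
  map_add' g h := by ext <;> simp <;> ring
  map_smul' r h := by ext <;> simp <;> ring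

/-- The functional `τ` in the rule `c h d = τ h + (imK h) (c b a d)`. -/
def contraction : ℍ[S,z,q] →ₗ[S] S where
  toFun h := -(z * h.re) + w * h.imI + y * h.imJ
  map_add' g h := by
    simp only [QuaternionAlgebra.re_add, QuaternionAlgebra.imI_add, QuaternionAlgebra.imJ_add]
    ring
  map_smul' r h := by
    simp only [QuaternionAlgebra.re_smul, QuaternionAlgebra.imI_smul, QuaternionAlgebra.imJ_smul,
      smul_eq_mul, RingHom.id_apply]
    ring

/-- The quaternion `κ` in the rule `d c b a d = κ d`. -/
def kappa : ℍ[S,z,q] := ⟨0, -y, w, -z⟩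

variable (q)

/-- The model of `e_M A`: the entry `(h₀, h₁, h₂)` stands for `h₀ + h₁ d c + h₂ d`, where the
quaternion units `1`, `i`, `j` and `k` stand for `e_M`, `b`, `a` and `b a`. -/
abbrev ModelM : Type _ := ℍ[S,z,q] × ℍ[S,z,q] × ℍ[S,z,q]

/-- The model of `e_R A`: the entry `(h, r, s)` stands for `c h + r e_R + s c b a d`. -/
abbrev ModelR : Type _ := ℍ[S,z,q] × S × S

/-- Left multiplication by `b` on `ModelM`. -/
def modelB : Module.End S (ModelM z q) :=
  Algebra.lsmul S S (ModelM z q) (⟨0, 1, 0, 0⟩ : ℍ[S,z,q])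

/-- Left multiplication by `a` on `ModelM`. -/
def modelA : Module.End S (ModelM z q) :=
  Algebra.lsmul S S (ModelM z q) (⟨0, 0, 1, 0⟩ : ℍ[S,z,q])

/-- Left multiplication by `c` from `ModelM` to `ModelR`. -/
def modelC : ModelM z q →ₗ[S] ModelR z q where
  toFun v := (v.1 - z • twist z v.2.1 - twistedDerivation z w y (twist z v.2.1),
    contraction z w y v.2.2, v.2.2.imK)
  map_add' u v := by
    refine Prod.ext ?_ (Prod.ext (map_add _ _ _) rfl)
    simp only [Prod.fst_add, Prod.snd_add, map_add, smul_add]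
    abel
  map_smul' r v := by
    refine Prod.ext ?_ (Prod.ext ?_ ?_) <;> simp [smul_sub, smul_comm z r]

/-- Left multiplication by `d` from `ModelR` to `ModelM`. -/
def modelD : ModelR z q →ₗ[S] ModelM z q where
  toFun v := (twistedDerivation z w y v.1, twist z v.1,
    v.2.1 • (1 : ℍ[S,z,q]) + v.2.2 • kappa z w y)
  map_add' u v := by
    refine Prod.ext (map_add _ _ _) (Prod.ext (map_add _ _ _) ?_)
    simp only [Prod.fst_add, Prod.snd_add, add_smul]
    abel
  map_smul' r v := by
    refine Prod.ext ?_ (Prod.ext ?_ ?_) <;> simp [mul_smul]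

variable {q}

theorem modelB_modelB (v : ModelM z q) : modelB z q (modelB z q v) = z • v := by
  ext <;> simp [modelB]

theorem modelA_modelA (v : ModelM z q) : modelA z q (modelA z q v) = q • v := by
  ext <;> simp [modelA]

theorem modelA_modelB (v : ModelM z q) :
    modelA z q (modelB z q v) + modelB z q (modelA z q v) = 0 := by
  ext <;> simp [modelA, modelB] <;> ring

theorem modelC_modelD (v : ModelR z q) :
    modelC z q w y (modelD z q w y v) = -(z • v) := by
  ext <;> simp [modelC, modelD, twist, twistedDerivation, contraction, kappa] <;> ring

theorem modelC_modelB_modelD (v : ModelR z q) :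
    modelC z q w y (modelB z q (modelD z q w y v)) = w • v := by
  ext <;> simp [modelC, modelD, modelB, twist, twistedDerivation, contraction, kappa] <;> ring

theorem modelB_modelD_modelC_add (v : ModelM z q) :
    modelB z q (modelD z q w y (modelC z q w y v)) + modelD z q w y (modelC z q w y (modelB z q v))
      = w • v - z • modelB z q v := by
  ext <;> simp [modelC, modelD, modelB, twist, twistedDerivation, contraction, kappa] <;> ring

/-- The action of the trivial paths on the model. -/
def modelIdem : Vertex → Module.End S (ModelM z q × ModelR z q)
  | .M => LinearMap.inl S _ _ ∘ₗ LinearMap.fst S _ _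
  | .R => LinearMap.inr S _ _ ∘ₗ LinearMap.snd S _ _

/-- The action of the arrows on the model. -/
def modelArrow {i j : Vertex} : (i ⟶ j) → Module.End S (ModelM z q × ModelR z q)
  | Arrow.a => LinearMap.inl S _ _ ∘ₗ modelA z q ∘ₗ LinearMap.fst S _ _
  | Arrow.b => LinearMap.inl S _ _ ∘ₗ modelB z q ∘ₗ LinearMap.fst S _ _
  | Arrow.c => LinearMap.inr S _ _ ∘ₗ modelC z q w y ∘ₗ LinearMap.fst S _ _
  | Arrow.d => LinearMap.inl S _ _ ∘ₗ modelD z q w y ∘ₗ LinearMap.snd S _ _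

theorem isRepresentation_modelArrow :
    PathAlgebra.IsRepresentation (modelIdem z (q := q)) (modelArrow z w y) where
  idem v := by cases v <;> rfl
  ortho := by
    rintro (_ | _) (_ | _) h
    · exact absurd rfl h
    · rfl
    · rfl
    · exact absurd rfl h
  complete := by
    refine (Finset.sum_pair (by decide)).trans (LinearMap.ext fun v => ?_)
    exact Prod.ext (zero_add v.1) (add_zero v.2)
  idem_mul_arrow {i j} (f : Arrow i j) := by cases f <;> rfl
  arrow_mul_idem {i j} (f : Arrow i j) := by cases f <;> rfl

section Action

variable [Algebra ℂ S]

variable (lam) in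
/-- The action of the algebra on the model, in which `a ^ 2` is multiplication by `-w - lam z`. -/
def action : Alg lam →ₐ[ℂ] Module.End S (ModelM z (-w - lam • z) × ModelR z (-w - lam • z)) :=
  Alg.lift (isRepresentation_modelArrow z w y)
    (LinearMap.ext fun v => by simp [modelArrow, pow_two, modelB_modelB, modelC_modelD])
    (LinearMap.ext fun v => by simp [modelArrow, pow_two, modelB_modelB, modelC_modelD])
    (LinearMap.ext fun v => Prod.ext (modelA_modelB z v.1) (add_zero 0))
    (LinearMap.ext fun v => Prod.ext (by
      have h := modelB_modelD_modelC_add z w y v.1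
      simp only [modelArrow, pow_succ, pow_zero, one_mul, LinearMap.add_apply,
        Module.End.mul_apply, LinearMap.coe_comp, LinearMap.coe_inl, LinearMap.coe_fst,
        Function.comp_apply, modelA_modelA, LinearMap.coe_inr, LinearMap.coe_snd,
        Prod.mk_add_mk, LinearMap.smul_apply, modelB_modelB, Prod.smul_mk, map_smul,
        LinearMap.zero_apply, Prod.fst_zero]
      rw [add_assoc (_ • _), h, sub_smul, neg_smul, smul_assoc]
      abel)
      (by simp [modelArrow, pow_succ]))

theorem action_e (i : Vertex) : action lam z w y (e lam i) = modelIdem z i :=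
  (RingQuot.liftAlgHom_mkAlgHom_apply _ _ _ _).trans
    ((isRepresentation_modelArrow z w y).lift_idem i)

theorem action_arrow {i j : Vertex} (f : Arrow i j) :
    action lam z w y (RingQuot.mkAlgHom ℂ (Rel lam) (arrow f))
      = modelArrow z w y (i := i) (j := j) f :=
  (RingQuot.liftAlgHom_mkAlgHom_apply _ _ _ _).trans
    ((isRepresentation_modelArrow z w y).lift_ofArrow _)

variable (v : ModelM z (-w - lam • z) × ModelR z (-w - lam • z))

theorem action_a : action lam z w y (a lam) v = (modelA z _ v.1, 0) :=
  LinearMap.congr_fun (action_arrow z w y .a) v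

theorem action_b : action lam z w y (b lam) v = (modelB z _ v.1, 0) :=
  LinearMap.congr_fun (action_arrow z w y .b) v

theorem action_c : action lam z w y (c lam) v = (0, modelC z _ w y v.1) :=
  LinearMap.congr_fun (action_arrow z w y .c) v

theorem action_d : action lam z w y (d lam) v = (modelD z _ w y v.2, 0) :=
  LinearMap.congr_fun (action_arrow z w y .d) v

end Action

section Regularity

variable {z w y}

theorem modelB_injective (hz : IsLeftRegular z) : Function.Injective (modelB z q) := by
  intro u v h
  have hzv : z • u = z • v := by rw [← modelB_modelB, h, modelB_modelB]
  simp only [Prod.ext_iff, QuaternionAlgebra.ext_iff] at hzv ⊢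
  simpa [hz.eq_iff] using hzv

theorem exists_modelB_of_modelA (hq : ∀ f, z ∣ q * f → z ∣ f) {u v : ModelM z q}
    (h : modelA z q v = modelB z q u) : ∃ v', v = modelB z q v' := by
  have hj {g h : ℍ[S,z,q]} (H : (⟨0, 0, 1, 0⟩ : ℍ[S,z,q]) * h = ⟨0, 1, 0, 0⟩ * g) :
      ∃ h', h = (⟨0, 1, 0, 0⟩ : ℍ[S,z,q]) * h' := by
    have hre : q * h.imJ = z * g.imI := by simpa using congrArg QuaternionAlgebra.re H
    have hJ : h.re = z * g.imK := by simpa using congrArg QuaternionAlgebra.imJ H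
    obtain ⟨f, hf⟩ := hq _ ⟨_, hre⟩
    exact ⟨⟨h.imI, g.imK, h.imK, f⟩, by ext <;> simp [hf, hJ]⟩
  obtain ⟨x₀, h₀⟩ := hj (congrArg (·.1) h)
  obtain ⟨x₁, h₁⟩ := hj (congrArg (·.2.1) h)
  obtain ⟨x₂, h₂⟩ := hj (congrArg (·.2.2) h)
  exact ⟨(x₀, x₁, x₂), Prod.ext h₀ (Prod.ext h₁ h₂)⟩

theorem modelD_injective (hz : IsLeftRegular z) : Function.Injective (modelD z q w y) := by
  intro r s h
  simp only [modelD, LinearMap.coe_mk, AddHom.coe_mk, Prod.ext_iff, QuaternionAlgebra.ext_iff,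
    twist, kappa] at h ⊢
  obtain ⟨-, hg, h₀, -, -, h₁⟩ := h
  exact ⟨by simpa using hg, by simpa using h₀, hz (by simpa [mul_comm] using h₁)⟩

theorem exists_modelC_of_mem_span {g : ℍ[S,z,q]} {r : S} (hre : g.re ∈ Ideal.span {z, w})
    (hJ : g.imJ ∈ Ideal.span {z, w}) (hr : r ∈ Ideal.span {z, w}) (s : S) :
    ∃ p u, ((g, r, s) : ModelR z q)
      = modelC z q w y (modelD z q w y p) + modelC z q w y (modelB z q u) := by
  rw [Ideal.mem_span_pair] at hre hJ hr
  obtain ⟨p₀, t₀, h₀⟩ := hre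
  obtain ⟨p₁, t₁, h₁⟩ := hJ
  obtain ⟨p₂, t₂, h₂⟩ := hr
  refine ⟨(⟨-p₀, 0, -p₁, 0⟩, -p₂, 0), modelD z q w y (⟨t₀, 0, t₁, 0⟩, t₂, 0)
    + (⟨g.imI, 0, g.imK, 0⟩, 0, ⟨0, 0, s, 0⟩), ?_⟩
  rw [map_add, map_add, modelC_modelD, modelC_modelB_modelD]
  ext <;> simp [modelC, modelB, contraction, ← h₀, ← h₁, ← h₂, mul_comm]

theorem exists_modelC_of_modelD (hq : q ∈ Ideal.span {z, w})
    (hy : ∀ f, y * f ∈ Ideal.span {z, w} → f ∈ Ideal.span {z, w}) {r : ModelR z q}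
    {u v : ModelM z q} (h : modelD z q w y r = modelA z q u + modelB z q v) :
    ∃ p u', r = modelC z q w y (modelD z q w y p) + modelC z q w y (modelB z q u') := by
  have hz : z ∈ Ideal.span {z, w} := Ideal.subset_span (Set.mem_insert _ _)
  have hw : w ∈ Ideal.span {z, w} := Ideal.subset_span (Set.mem_insert_of_mem _ rfl)
  have hre {i j k : ℍ[S,z,q]}
      (hk : k = (⟨0, 0, 1, 0⟩ : ℍ[S,z,q]) * i + (⟨0, 1, 0, 0⟩ : ℍ[S,z,q]) * j) :
      k.re ∈ Ideal.span {z, w} := by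
    rw [hk]
    simpa using add_mem (Ideal.mul_mem_right i.imJ _ hq) (Ideal.mul_mem_right j.imI _ hz)
  have h₀ : r.1.re ∈ Ideal.span {z, w} :=
    hre (k := twist z r.1) (congrArg (·.2.1) h)
  have h₁ : w * r.1.imI + y * r.1.imJ ∈ Ideal.span {z, w} := hre (congrArg (·.1) h)
  have h₂ : r.2.1 ∈ Ideal.span {z, w} := by
    simpa [modelD, kappa] using hre (congrArg (·.2.2) h)
  exact exists_modelC_of_mem_span h₀
    (hy _ ((Ideal.add_mem_iff_right _ (Ideal.mul_mem_right _ _ hw)).1 h₁)) h₂ _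

end Regularity

end Model

/-! ## Central elements -/

section Central

theorem mem_center_of_commute {s : Alg lam} (he : ∀ v, Commute s (e lam v))
    (ha : Commute s (a lam)) (hb : Commute s (b lam)) (hc : Commute s (c lam))
    (hd : Commute s (d lam)) : s ∈ Subalgebra.center ℂ (Alg lam) := by
  refine Subalgebra.mem_center_iff.2 fun u => (?_ : Commute s u).symm
  induction u using Alg.induction with
  | add x y hx hy => exact hx.add_right hy
  | smul r x hx => exact hx.smul_right r
  | idem v => exact he v
  | a_mul x hx => exact ha.mul_right hx
  | b_mul x hx => exact hb.mul_right hx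
  | c_mul x hx => exact hc.mul_right hx
  | d_mul x hx => exact hd.mul_right hx

theorem add_mem_center {x y : Alg lam} (hx : e lam .M * x = x) (hx' : x * e lam .M = x)
    (hy : e lam .R * y = y) (hy' : y * e lam .R = y) (ha : Commute (a lam) x)
    (hb : Commute (b lam) x) (hc : c lam * x = y * c lam) (hd : x * d lam = d lam * y) :
    x + y ∈ Subalgebra.center ℂ (Alg lam) := by
  have hxR {u : Alg lam} (hu : e lam .R * u = u) : x * u = 0 :=
    mul_eq_zero_of_ne hx' hu (by decide)
  have hyM {u : Alg lam} (hu : e lam .M * u = u) : y * u = 0 :=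
    mul_eq_zero_of_ne hy' hu (by decide)
  have hRx {u : Alg lam} (hu : u * e lam .R = u) : u * x = 0 :=
    mul_eq_zero_of_ne hu hx (by decide)
  have hMy {u : Alg lam} (hu : u * e lam .M = u) : u * y = 0 :=
    mul_eq_zero_of_ne hu hy (by decide)
  refine mem_center_of_commute ?_ ?_ ?_ ?_ ?_
  · rintro (_ | _) <;> rw [commute_iff_eq, add_mul, mul_add]
    · rw [hxR (e_mul_e_self lam .R), hRx (e_mul_e_self lam .R), hy, hy']
    · rw [hyM (e_mul_e_self lam .M), hMy (e_mul_e_self lam .M), hx, hx']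
  all_goals rw [commute_iff_eq, add_mul, mul_add]
  · rw [ha.eq, hyM (e_mul_a lam), hMy (a_mul_e lam)]
  · rw [hb.eq, hyM (e_mul_b lam), hMy (b_mul_e lam)]
  · rw [hc, hxR (e_mul_c lam), hMy (c_mul_e lam), zero_add, add_zero]
  · rw [hd, hyM (e_mul_d lam), hRx (d_mul_e lam), zero_add, add_zero]

variable (lam)

theorem b_sq_sub_mem_center :
    b lam * b lam + -(c lam * d lam) ∈ Subalgebra.center ℂ (Alg lam) := by
  refine add_mem_center ?_ ?_ ?_ ?_ (commute_a_b_sq (relation_ab lam))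
    ((Commute.refl _).mul_right (Commute.refl _)) ?_ ?_
  · rw [← mul_assoc, e_mul_b]
  · rw [mul_assoc, b_mul_e]
  · rw [mul_neg, ← mul_assoc, e_mul_c]
  · rw [neg_mul, mul_assoc, d_mul_e]
  · linear_combination (norm := noncomm_ring) relation_c lam
  · linear_combination (norm := noncomm_ring) relation_d lam

theorem polar_mul_e {x : Alg lam} (hx : x * e lam .M = x) :
    polar (b lam) (d lam * c lam) x * e lam .M = polar (b lam) (d lam * c lam) x := by
  simp only [polar, add_mul, mul_assoc, c_mul_e, hx]

theorem polar_add_mem_center {x : Alg lam} (hx : e lam .M * x = x) (hx' : x * e lam .M = x)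
    (hxb : Commute x (b lam * b lam))
    (ha : Commute (a lam) (polar (b lam) (d lam * c lam) x))
    (hb : Commute (b lam) (polar (b lam) (d lam * c lam) x)) :
    polar (b lam) (d lam * c lam) x + c lam * x * d lam ∈ Subalgebra.center ℂ (Alg lam) := by
  refine add_mem_center ?_ (polar_mul_e lam hx') ?_ ?_ ha hb ?_ ?_
  · simp only [polar, mul_add, ← mul_assoc, e_mul_d, e_mul_b, hx]
  · simp only [← mul_assoc, e_mul_c]
  · rw [mul_assoc, d_mul_e]
  · rw [mul_polar (relation_c lam)]
    simp only [mul_assoc]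
  · rw [polar_mul (relation_d lam) hxb]
    simp only [mul_assoc]

theorem polar_b_mem_center :
    polar (b lam) (d lam * c lam) (b lam) + c lam * b lam * d lam
      ∈ Subalgebra.center ℂ (Alg lam) :=
  polar_add_mem_center lam (e_mul_b lam) (b_mul_e lam)
    ((Commute.refl _).mul_right (Commute.refl _))
    (commute_a_polar_b (Algebra.commutes lam _) (relation_ab lam) (relation_a_sq lam))
    (commute_b_polar_b (commute_b_sq_mul (relation_d lam) (relation_c lam)))

theorem polar_a_mem_center :
    polar (b lam) (d lam * c lam) (a lam) + c lam * a lam * d lam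
      ∈ Subalgebra.center ℂ (Alg lam) :=
  polar_add_mem_center lam (e_mul_a lam) (a_mul_e lam) (commute_a_b_sq (relation_ab lam))
    (commute_a_polar_a (Algebra.commutes lam _)
      (commute_b_sq_mul (relation_d lam) (relation_c lam))
      (by linear_combination (norm := noncomm_ring) relation_d lam * c lam)
      (relation_ab lam) (relation_a_sq lam))
    (commute_b_polar_a (Algebra.commutes lam _) (relation_ab lam) (relation_a_sq lam))

/-- The polynomial ring `ℂ[z, w, y]`, with `z = X 0`, `w = X 1` and `y = X 2`. -/
abbrev Coeff : Type := MvPolynomial (Fin 3) ℂ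

/-- The evaluation of a polynomial at the three central elements `z = b² - c d`,
`w = d c b + b d c + b³ + c b d` and `y = d c a + a d c + b² a + c a d`. -/
def evalCentral : Coeff →ₐ[ℂ] Alg lam :=
  (Subalgebra.center ℂ (Alg lam)).val.comp (MvPolynomial.aeval
    ![⟨_, b_sq_sub_mem_center lam⟩, ⟨_, polar_b_mem_center lam⟩, ⟨_, polar_a_mem_center lam⟩])

instance : Algebra Coeff (Alg lam) :=
  (evalCentral lam).toRingHom.toAlgebra' fun f x =>
    (Subalgebra.mem_center_iff.1 (SetLike.coe_mem (MvPolynomial.aeval _ f)) x).symm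

theorem coeff_smul_def (f : Coeff) (x : Alg lam) : f • x = evalCentral lam f * x := rfl

instance : IsScalarTower ℂ Coeff (Alg lam) :=
  IsScalarTower.of_algebraMap_eq fun r => ((evalCentral lam).commutes r).symm

open MvPolynomial

variable {lam} {x : Alg lam}

theorem z_smul_M (hx : e lam .M * x = x) : (X 0 : Coeff) • x = b lam * b lam * x := by
  have h : c lam * d lam * x = 0 :=
    mul_eq_zero_of_ne (by rw [mul_assoc, d_mul_e]) hx (by decide)
  simp [coeff_smul_def, evalCentral, add_mul, h]

theorem z_smul_R (hx : e lam .R * x = x) : (X 0 : Coeff) • x = -(c lam * d lam * x) := by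
  have h : b lam * b lam * x = 0 :=
    mul_eq_zero_of_ne (by rw [mul_assoc, b_mul_e]) hx (by decide)
  simp [coeff_smul_def, evalCentral, add_mul, h]

theorem w_smul_M (hx : e lam .M * x = x) :
    (X 1 : Coeff) • x = polar (b lam) (d lam * c lam) (b lam) * x := by
  have h : c lam * b lam * d lam * x = 0 :=
    mul_eq_zero_of_ne (by rw [mul_assoc, d_mul_e]) hx (by decide)
  simp [coeff_smul_def, evalCentral, add_mul, h]

theorem w_smul_R (hx : e lam .R * x = x) :
    (X 1 : Coeff) • x = c lam * b lam * d lam * x := by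
  have h : polar (b lam) (d lam * c lam) (b lam) * x = 0 :=
    mul_eq_zero_of_ne (polar_mul_e lam (b_mul_e lam)) hx (by decide)
  simp [coeff_smul_def, evalCentral, add_mul, h]

theorem y_smul_M (hx : e lam .M * x = x) :
    (X 2 : Coeff) • x = polar (b lam) (d lam * c lam) (a lam) * x := by
  have h : c lam * a lam * d lam * x = 0 :=
    mul_eq_zero_of_ne (by rw [mul_assoc, d_mul_e]) hx (by decide)
  simp [coeff_smul_def, evalCentral, add_mul, h]

theorem y_smul_R (hx : e lam .R * x = x) :
    (X 2 : Coeff) • x = c lam * a lam * d lam * x := by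
  have h : polar (b lam) (d lam * c lam) (a lam) * x = 0 :=
    mul_eq_zero_of_ne (polar_mul_e lam (a_mul_e lam)) hx (by decide)
  simp [coeff_smul_def, evalCentral, add_mul, h]

variable (lam) in
/-- The polynomial by which `a ^ 2` acts on `e_M A`. -/
abbrev aSq : Coeff := -X 1 - lam • X 0

theorem aSq_smul_M (hx : e lam .M * x = x) : aSq lam • x = a lam * a lam * x := by
  rw [sub_smul, neg_smul, smul_assoc, z_smul_M hx, w_smul_M hx, polar, Algebra.smul_def]
  linear_combination (norm := noncomm_ring) -relation_a_sq lam * x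

theorem X_zero_dvd_of_dvd_aSq_mul (f : Coeff) (h : X 0 ∣ aSq lam * f) : X 0 ∣ f := by
  refine ((X_prime (R := ℂ) (i := (0 : Fin 3))).dvd_or_dvd h).resolve_left fun h' => ?_
  have h₁ : (X 0 : Coeff) ∣ X 1 := by
    simpa using (dvd_sub_left (dvd_smul_of_dvd lam (dvd_refl (X 0 : Coeff)))).1 h'
  exact absurd (X_dvd_X.1 h₁) (by decide)

theorem mem_span_of_X_two_mul_mem_span (f : Coeff)
    (h : X 2 * f ∈ Ideal.span {(X 0 : Coeff), X 1}) : f ∈ Ideal.span {(X 0 : Coeff), X 1} := by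
  rw [← Set.image_pair, mem_ideal_span_X_image] at h ⊢
  intro m hm
  obtain ⟨i, hi, hmi⟩ := h (Finsupp.single 2 1 + m)
    (by rw [support_X_mul]; exact Finset.mem_map_of_mem _ hm)
  refine ⟨i, hi, ?_⟩
  rcases hi with rfl | rfl <;> simpa using hmi

theorem aSq_mem_span : aSq lam ∈ Ideal.span {(X 0 : Coeff), X 1} := by
  refine sub_mem (neg_mem (Ideal.subset_span (by simp))) ?_
  exact Submodule.smul_of_tower_mem _ lam (Ideal.subset_span (by simp))

end Central

/-! ## The model as a normal form -/

section Realization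

open MvPolynomial
open scoped Quaternion

variable (lam)

/-- The element of the algebra represented by a quaternion. -/
def realizeQuaternion : ℍ[Coeff,X 0,aSq lam] →ₗ[Coeff] Alg lam where
  toFun h := h.re • e lam .M + h.imI • b lam + h.imJ • a lam + h.imK • (b lam * a lam)
  map_add' g h := by
    simp only [QuaternionAlgebra.re_add, QuaternionAlgebra.imI_add, QuaternionAlgebra.imJ_add,
      QuaternionAlgebra.imK_add]
    module
  map_smul' r h := by simp [smul_smul]

theorem realizeQuaternion_apply (h : ℍ[Coeff,X 0,aSq lam]) : realizeQuaternion lam h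
    = h.re • e lam .M + h.imI • b lam + h.imJ • a lam + h.imK • (b lam * a lam) := rfl

/-- The element of `e_M A` represented by an element of the model. -/
def realizeM : ModelM (X 0) (aSq lam) →ₗ[Coeff] Alg lam :=
  (realizeQuaternion lam).coprod
    ((LinearMap.mulRight Coeff (d lam * c lam) ∘ₗ realizeQuaternion lam).coprod
      (LinearMap.mulRight Coeff (d lam) ∘ₗ realizeQuaternion lam))

/-- The element of `e_R A` represented by an element of the model. -/
def realizeR : ModelR (X 0) (aSq lam) →ₗ[Coeff] Alg lam :=
  (LinearMap.mulLeft Coeff (c lam) ∘ₗ realizeQuaternion lam).coprod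
    ((LinearMap.toSpanSingleton Coeff (Alg lam) (e lam .R)).coprod
      (LinearMap.toSpanSingleton Coeff (Alg lam) (c lam * (b lam * a lam) * d lam)))

theorem realizeM_apply (v : ModelM (X 0) (aSq lam)) :
    realizeM lam v = realizeQuaternion lam v.1
      + (realizeQuaternion lam v.2.1 * (d lam * c lam) + realizeQuaternion lam v.2.2 * d lam) := rfl

theorem realizeR_apply (r : ModelR (X 0) (aSq lam)) :
    realizeR lam r = c lam * realizeQuaternion lam r.1
      + (r.2.1 • e lam .R + r.2.2 • (c lam * (b lam * a lam) * d lam)) := rfl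

theorem e_mul_realizeQuaternion (h : ℍ[Coeff,X 0,aSq lam]) :
    e lam .M * realizeQuaternion lam h = realizeQuaternion lam h := by
  simp only [realizeQuaternion_apply, mul_add, mul_smul_comm, ← mul_assoc (e lam _),
    e_mul_e_self, e_mul_a, e_mul_b]

theorem e_mul_realizeM (v : ModelM (X 0) (aSq lam)) :
    e lam .M * realizeM lam v = realizeM lam v := by
  simp only [realizeM_apply, mul_add, ← mul_assoc (e lam _), e_mul_realizeQuaternion]

theorem e_mul_realizeR (r : ModelR (X 0) (aSq lam)) :
    e lam .R * realizeR lam r = realizeR lam r := by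
  simp only [realizeR_apply, mul_add, mul_smul_comm, ← mul_assoc (e lam _), e_mul_e_self, e_mul_c]

theorem b_mul_realizeQuaternion (h : ℍ[Coeff,X 0,aSq lam]) : b lam * realizeQuaternion lam h
    = realizeQuaternion lam ((⟨0, 1, 0, 0⟩ : ℍ[Coeff,X 0,aSq lam]) * h) := by
  have h₁ : b lam * b lam = (X 0 : Coeff) • e lam .M := by
    rw [z_smul_M (e_mul_e_self lam .M), mul_assoc, b_mul_e]
  have h₂ : b lam * (b lam * a lam) = (X 0 : Coeff) • a lam := by
    rw [z_smul_M (e_mul_a lam), mul_assoc]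
  simp only [realizeQuaternion_apply, mul_add, mul_smul_comm, b_mul_e, h₁, h₂,
    QuaternionAlgebra.re_mul, QuaternionAlgebra.imI_mul, QuaternionAlgebra.imJ_mul,
    QuaternionAlgebra.imK_mul]
  module

theorem a_mul_realizeQuaternion (h : ℍ[Coeff,X 0,aSq lam]) : a lam * realizeQuaternion lam h
    = realizeQuaternion lam ((⟨0, 0, 1, 0⟩ : ℍ[Coeff,X 0,aSq lam]) * h) := by
  have h₁ : a lam * b lam = -(b lam * a lam) := eq_neg_of_add_eq_zero_left (relation_ab lam)
  have h₂ : a lam * a lam = aSq lam • e lam .M := by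
    rw [aSq_smul_M (e_mul_e_self lam .M), mul_assoc, a_mul_e]
  have h₃ : a lam * (b lam * a lam) = -(aSq lam • b lam) := by
    rw [aSq_smul_M (e_mul_b lam)]
    linear_combination (norm := noncomm_ring) a lam * relation_ab lam
  simp only [realizeQuaternion_apply, mul_add, mul_smul_comm, a_mul_e, h₁, h₂, h₃,
    QuaternionAlgebra.re_mul, QuaternionAlgebra.imI_mul, QuaternionAlgebra.imJ_mul,
    QuaternionAlgebra.imK_mul]
  module

theorem b_mul_realizeM (v : ModelM (X 0) (aSq lam)) :
    b lam * realizeM lam v = realizeM lam (modelB (X 0) (aSq lam) v) := by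
  simp only [realizeM_apply, mul_add, ← mul_assoc (b lam), b_mul_realizeQuaternion]
  rfl

theorem a_mul_realizeM (v : ModelM (X 0) (aSq lam)) :
    a lam * realizeM lam v = realizeM lam (modelA (X 0) (aSq lam) v) := by
  simp only [realizeM_apply, mul_add, ← mul_assoc (a lam), a_mul_realizeQuaternion]
  rfl

theorem d_mul_c_mul_realizeQuaternion (h : ℍ[Coeff,X 0,aSq lam]) :
    d lam * c lam * realizeQuaternion lam h
      = realizeQuaternion lam (twistedDerivation (X 0) (X 1) (X 2) h)
        + realizeQuaternion lam (twist (X 0) h) * (d lam * c lam) := by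
  have hb : d lam * c lam * b lam
      = (X 1 : Coeff) • e lam .M - (X 0 : Coeff) • b lam - b lam * (d lam * c lam) := by
    rw [z_smul_M (e_mul_b lam), w_smul_M (e_mul_e_self lam .M), polar_mul_e lam (b_mul_e lam)]
    exact mul_eq_polar_sub
  have ha : d lam * c lam * a lam
      = (X 2 : Coeff) • e lam .M - (X 0 : Coeff) • a lam - a lam * (d lam * c lam) := by
    rw [z_smul_M (e_mul_a lam), y_smul_M (e_mul_e_self lam .M), polar_mul_e lam (a_mul_e lam)]
    exact mul_eq_polar_sub
  have hba : d lam * c lam * (b lam * a lam)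
      = (X 1 : Coeff) • a lam - (X 2 : Coeff) • b lam + b lam * a lam * (d lam * c lam) := by
    rw [w_smul_M (e_mul_a lam), y_smul_M (e_mul_b lam), mul_assoc (b lam)]
    exact mul_b_mul_a_eq (Algebra.commutes lam _) (relation_ab lam) (relation_a_sq lam)
  have he : d lam * c lam * e lam .M = e lam .M * (d lam * c lam) := by
    rw [mul_assoc, c_mul_e, ← mul_assoc, e_mul_d]
  simp only [realizeQuaternion_apply, mul_add, mul_smul_comm, ha, hb, hba, he, add_mul,
    smul_mul_assoc, twist, twistedDerivation, LinearMap.coe_mk, AddHom.coe_mk]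
  module

theorem d_mul_c_mul_d : d lam * c lam * d lam = -((X 0 : Coeff) • d lam) := by
  rw [z_smul_M (e_mul_d lam)]
  linear_combination (norm := noncomm_ring) relation_d lam

theorem c_mul_d_mul_c : c lam * (d lam * c lam) = -((X 0 : Coeff) • c lam) := by
  rw [z_smul_R (e_mul_c lam), neg_neg, mul_assoc]

theorem c_mul_realizeQuaternion_mul_d (h : ℍ[Coeff,X 0,aSq lam]) :
    c lam * realizeQuaternion lam h * d lam
      = contraction (X 0) (X 1) (X 2) h • e lam .R
        + h.imK • (c lam * (b lam * a lam) * d lam) := by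
  have he : c lam * e lam .M * d lam = -((X 0 : Coeff) • e lam .R) := by
    rw [z_smul_R (e_mul_e_self lam .R), neg_neg, c_mul_e, mul_assoc, d_mul_e]
  have hb : c lam * b lam * d lam = (X 1 : Coeff) • e lam .R := by
    rw [w_smul_R (e_mul_e_self lam .R), mul_assoc _ (d lam), d_mul_e]
  have ha : c lam * a lam * d lam = (X 2 : Coeff) • e lam .R := by
    rw [y_smul_R (e_mul_e_self lam .R), mul_assoc _ (d lam), d_mul_e]
  simp only [realizeQuaternion_apply, mul_add, add_mul, mul_smul_comm, smul_mul_assoc, ha, hb, he,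
    contraction, LinearMap.coe_mk, AddHom.coe_mk]
  module

theorem c_mul_realizeQuaternion_mul_d_mul_c (h : ℍ[Coeff,X 0,aSq lam]) :
    c lam * (realizeQuaternion lam h * (d lam * c lam))
      = -((X 0 : Coeff) • (c lam * realizeQuaternion lam (twist (X 0) h)))
        - c lam * realizeQuaternion lam (twistedDerivation (X 0) (X 1) (X 2) (twist (X 0) h)) := by
  have hσ : twist (X 0) (twist (X 0) h) = h := by ext <;> simp [twist]
  have key := congrArg (c lam * ·) (d_mul_c_mul_realizeQuaternion lam (twist (X 0) h))
  simp only [hσ, mul_add, ← mul_assoc (c lam) (d lam * c lam), c_mul_d_mul_c, neg_mul,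
    smul_mul_assoc] at key
  rw [key, add_sub_cancel_left]

theorem d_mul_realizeR (r : ModelR (X 0) (aSq lam)) :
    d lam * realizeR lam r = realizeM lam (modelD (X 0) (aSq lam) (X 1) (X 2) r) := by
  have hκ : d lam * (c lam * (b lam * a lam) * d lam)
      = realizeQuaternion lam (kappa (X 0) (X 1) (X 2)) * d lam := by
    have h := congrArg (· * d lam) (d_mul_c_mul_realizeQuaternion lam ⟨0, 0, 0, 1⟩)
    simp only [add_mul, mul_assoc _ (d lam * c lam) (d lam), d_mul_c_mul_d] at h
    simp only [realizeQuaternion_apply, twist, twistedDerivation, kappa, LinearMap.coe_mk,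
      AddHom.coe_mk, zero_smul, one_smul, zero_add, mul_zero, mul_one, neg_zero, zero_sub, add_zero,
      mul_neg, mul_smul_comm, smul_mul_assoc, add_mul] at h ⊢
    rw [← mul_assoc, ← mul_assoc, h]
    simp only [neg_smul]
  have h₁ : realizeQuaternion lam 1 * d lam = d lam := by
    simp [realizeQuaternion_apply, e_mul_d]
  simp only [realizeM_apply, realizeR_apply, modelD, LinearMap.coe_mk, AddHom.coe_mk, map_add,
    map_smul, mul_add, add_mul, mul_smul_comm, smul_mul_assoc, d_mul_e, hκ, h₁]
  rw [← mul_assoc, d_mul_c_mul_realizeQuaternion, add_assoc]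

theorem c_mul_realizeM (v : ModelM (X 0) (aSq lam)) :
    c lam * realizeM lam v = realizeR lam (modelC (X 0) (aSq lam) (X 1) (X 2) v) := by
  simp only [realizeM_apply, realizeR_apply, modelC, LinearMap.coe_mk, AddHom.coe_mk, mul_add,
    c_mul_realizeQuaternion_mul_d_mul_c, ← mul_assoc _ _ (d lam), c_mul_realizeQuaternion_mul_d,
    map_sub, map_smul, mul_sub, mul_smul_comm]
  abel

/-- The element of the algebra represented by an element of the model. -/
def realize : ModelM (X 0) (aSq lam) × ModelR (X 0) (aSq lam) →ₗ[Coeff] Alg lam :=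
  (realizeM lam).coprod (realizeR lam)

theorem realize_apply (v : ModelM (X 0) (aSq lam) × ModelR (X 0) (aSq lam)) :
    realize lam v = realizeM lam v.1 + realizeR lam v.2 := rfl

theorem realize_modelM (u : ModelM (X 0) (aSq lam)) : realize lam (u, 0) = realizeM lam u := by
  rw [realize_apply, map_zero, add_zero]

theorem realize_modelR (r : ModelR (X 0) (aSq lam)) : realize lam (0, r) = realizeR lam r := by
  rw [realize_apply, map_zero, zero_add]

theorem mul_realize_of_mul_e_M {x : Alg lam} (hx : x * e lam .M = x)
    (v : ModelM (X 0) (aSq lam) × ModelR (X 0) (aSq lam)) :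
    x * realize lam v = x * realizeM lam v.1 := by
  rw [realize_apply, mul_add, mul_eq_zero_of_ne hx (e_mul_realizeR lam v.2) (by decide), add_zero]

theorem mul_realize_of_mul_e_R {x : Alg lam} (hx : x * e lam .R = x)
    (v : ModelM (X 0) (aSq lam) × ModelR (X 0) (aSq lam)) :
    x * realize lam v = x * realizeR lam v.2 := by
  rw [realize_apply, mul_add, mul_eq_zero_of_ne hx (e_mul_realizeM lam v.1) (by decide), zero_add]

section Action

variable (v : ModelM (X 0) (aSq lam) × ModelR (X 0) (aSq lam))

theorem realize_action_e (i : Vertex) :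
    realize lam (action lam (X 0) (X 1) (X 2) (e lam i) v) = e lam i * realize lam v := by
  cases i with
  | M =>
    rw [mul_realize_of_mul_e_M lam (e_mul_e_self lam .M), e_mul_realizeM, action_e]
    exact realize_modelM lam v.1
  | R =>
    rw [mul_realize_of_mul_e_R lam (e_mul_e_self lam .R), e_mul_realizeR, action_e]
    exact realize_modelR lam v.2

theorem realize_action_a :
    realize lam (action lam (X 0) (X 1) (X 2) (a lam) v) = a lam * realize lam v := by
  rw [mul_realize_of_mul_e_M lam (a_mul_e lam), a_mul_realizeM, action_a]
  exact realize_modelM lam _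

theorem realize_action_b :
    realize lam (action lam (X 0) (X 1) (X 2) (b lam) v) = b lam * realize lam v := by
  rw [mul_realize_of_mul_e_M lam (b_mul_e lam), b_mul_realizeM, action_b]
  exact realize_modelM lam _

theorem realize_action_c :
    realize lam (action lam (X 0) (X 1) (X 2) (c lam) v) = c lam * realize lam v := by
  rw [mul_realize_of_mul_e_M lam (c_mul_e lam), c_mul_realizeM, action_c]
  exact realize_modelR lam _

theorem realize_action_d :
    realize lam (action lam (X 0) (X 1) (X 2) (d lam) v) = d lam * realize lam v := by
  rw [mul_realize_of_mul_e_R lam (d_mul_e lam), d_mul_realizeR, action_d]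
  exact realize_modelM lam _

theorem realize_action_mul {x y : Alg lam}
    (hx : ∀ v, realize lam (action lam (X 0) (X 1) (X 2) x v) = x * realize lam v)
    (hy : ∀ v, realize lam (action lam (X 0) (X 1) (X 2) y v) = y * realize lam v) :
    realize lam (action lam (X 0) (X 1) (X 2) (x * y) v) = x * y * realize lam v := by
  rw [map_mul, mul_assoc, ← hy]
  exact hx _

variable {lam} in
theorem realize_action (x : Alg lam) :
    realize lam (action lam (X 0) (X 1) (X 2) x v) = x * realize lam v := by
  induction x using Alg.induction generalizing v with
  | add x y hx hy => rw [map_add, LinearMap.add_apply, map_add, hx, hy, add_mul]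
  | smul r x hx =>
    rw [map_smul, LinearMap.smul_apply, LinearMap.map_smul_of_tower, hx, smul_mul_assoc]
  | idem i => exact realize_action_e lam v i
  | a_mul x hx => exact realize_action_mul lam v (realize_action_a lam) hx
  | b_mul x hx => exact realize_action_mul lam v (realize_action_b lam) hx
  | c_mul x hx => exact realize_action_mul lam v (realize_action_c lam) hx
  | d_mul x hx => exact realize_action_mul lam v (realize_action_d lam) hx

end Action

/-- The element of the model that stands for the unit `e_M + e_R`. -/
def modelOne : ModelM (X 0) (aSq lam) × ModelR (X 0) (aSq lam) := ((1, 0, 0), (0, 1, 0))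

theorem realize_modelOne : realize lam (modelOne lam) = 1 := by
  rw [one_eq_e_add_e, realize_apply, realizeM_apply, realizeR_apply]
  simp [modelOne, realizeQuaternion_apply]

/-- The coordinates of an element of the algebra, given by its action on `modelOne`. -/
def coords : Alg lam →ₗ[ℂ] ModelM (X 0) (aSq lam) × ModelR (X 0) (aSq lam) :=
  LinearMap.applyₗ' ℂ (modelOne lam) ∘ₗ (action lam (X 0) (X 1) (X 2)).toLinearMap

theorem realize_coords (x : Alg lam) : realize lam (coords lam x) = x := by
  refine (realize_action (modelOne lam) x).trans ?_
  rw [realize_modelOne, mul_one]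

theorem coords_mul (x y : Alg lam) :
    coords lam (x * y) = action lam (X 0) (X 1) (X 2) x (coords lam y) :=
  LinearMap.congr_fun (map_mul (action lam (X 0) (X 1) (X 2)) x y) (modelOne lam)

end Realization

section Regularity

open MvPolynomial

variable {x y u v : Alg lam}

theorem coords_snd_of_M (hx : e lam .M * x = x) : (coords lam x).2 = 0 := by
  rw [← hx, coords_mul, action_e]
  rfl

theorem coords_fst_of_R (hx : e lam .R * x = x) : (coords lam x).1 = 0 := by
  rw [← hx, coords_mul, action_e]
  rfl

theorem realizeM_coords (hx : e lam .M * x = x) : realizeM lam (coords lam x).1 = x := by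
  rw [← realize_modelM, ← coords_snd_of_M hx]
  exact realize_coords lam x

theorem realizeR_coords (hx : e lam .R * x = x) : realizeR lam (coords lam x).2 = x := by
  rw [← realize_modelR, ← coords_fst_of_R hx]
  exact realize_coords lam x

variable (x) in
theorem coords_a_mul_fst :
    (coords lam (a lam * x)).1 = modelA (X 0) (aSq lam) (coords lam x).1 := by
  rw [coords_mul, action_a]

variable (x) in
theorem coords_b_mul_fst :
    (coords lam (b lam * x)).1 = modelB (X 0) (aSq lam) (coords lam x).1 := by
  rw [coords_mul, action_b]

variable (x) in
theorem coords_d_mul_fst :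
    (coords lam (d lam * x)).1 = modelD (X 0) (aSq lam) (X 1) (X 2) (coords lam x).2 := by
  rw [coords_mul, action_d]

theorem isLeftRegular_X_zero : IsLeftRegular (X 0 : Coeff) :=
  (IsRegular.of_ne_zero (X_ne_zero 0)).left

theorem b_mul_cancel (hx : e lam .M * x = x) (hy : e lam .M * y = y)
    (h : b lam * x = b lam * y) : x = y := by
  rw [← realizeM_coords hx, ← realizeM_coords hy]
  refine congrArg (realizeM lam) (modelB_injective isLeftRegular_X_zero ?_)
  rw [← coords_b_mul_fst, h, coords_b_mul_fst]

theorem d_mul_cancel (hx : e lam .R * x = x) (hy : e lam .R * y = y)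
    (h : d lam * x = d lam * y) : x = y := by
  rw [← realizeR_coords hx, ← realizeR_coords hy]
  refine congrArg (realizeR lam)
    (modelD_injective (w := X 1) (y := X 2) isLeftRegular_X_zero ?_)
  rw [← coords_d_mul_fst, h, coords_d_mul_fst]

theorem exists_b_mul_of_a_mul (hx : e lam .M * x = x) (h : a lam * x = b lam * u) :
    ∃ v, x = b lam * v := by
  have h' : modelA (X 0) (aSq lam) (coords lam x).1 = modelB (X 0) (aSq lam) (coords lam u).1 := by
    rw [← coords_a_mul_fst, h, coords_b_mul_fst]
  obtain ⟨v, hv⟩ := exists_modelB_of_modelA X_zero_dvd_of_dvd_aSq_mul h'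
  exact ⟨realizeM lam v, by rw [b_mul_realizeM, ← hv, realizeM_coords hx]⟩

theorem exists_c_mul_of_d_mul (hx : e lam .R * x = x)
    (h : d lam * x = a lam * u + b lam * v) :
    ∃ r s, x = c lam * d lam * r + c lam * b lam * s := by
  have h' : modelD (X 0) (aSq lam) (X 1) (X 2) (coords lam x).2
      = modelA (X 0) (aSq lam) (coords lam u).1 + modelB (X 0) (aSq lam) (coords lam v).1 := by
    rw [← coords_d_mul_fst, h, map_add, Prod.fst_add, coords_a_mul_fst, coords_b_mul_fst]
  obtain ⟨r, s, hrs⟩ :=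
    exists_modelC_of_modelD aSq_mem_span mem_span_of_X_two_mul_mem_span h'
  refine ⟨realizeR lam r, realizeM lam s, ?_⟩
  rw [mul_assoc, mul_assoc, d_mul_realizeR, b_mul_realizeM, c_mul_realizeM, c_mul_realizeM,
    ← map_add, ← hrs, realizeR_coords hx]

end Regularity

/-! ## Exactness -/

section Resolution

theorem mem_P_iff {v : Vertex} {x : Alg lam} : x ∈ P lam v ↔ e lam v * x = x := by
  refine ⟨?_, fun h => ⟨x, h⟩⟩
  rintro ⟨y, rfl⟩
  change e lam v * (e lam v * y) = e lam v * y
  rw [← mul_assoc, e_mul_e_self]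

theorem e_mul_coe {v : Vertex} (x : P lam v) : e lam v * (x : Alg lam) = x := mem_P_iff.1 x.2

theorem e_mul_mem_P (v : Vertex) (x : Alg lam) : e lam v * x ∈ P lam v := ⟨x, rfl⟩

theorem coe_mulMap {i j : Vertex} (x : Alg lam) (hx : e lam j * x = x) (y : P lam i) :
    (mulMap lam i j x hx y : Alg lam) = x * y := rfl

variable (lam) in
theorem projective_P (v : Vertex) : Module.Projective (Alg lam)ᵐᵒᵖ (P lam v) :=
  have : Module.Projective (Alg lam)ᵐᵒᵖ (Alg lam) :=
    .of_equiv (MulOpposite.opLinearEquiv (Alg lam)ᵐᵒᵖ).symm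
  .of_split (P lam v).subtype (leftMul lam (e lam v)).rangeRestrict
    (LinearMap.ext fun x => Subtype.ext (e_mul_coe x))

variable (lam) in
theorem mulMap_b_injective : Function.Injective (mulMap lam .M .M (b lam) (e_mul_b lam)) :=
  fun u v h => Subtype.ext (b_mul_cancel (e_mul_coe u) (e_mul_coe v) (congrArg Subtype.val h))

variable (lam) in
theorem f₂_injective : Function.Injective (f₂ lam) := fun _ _ h =>
  mulMap_b_injective lam (congrArg (·.2.2) h)

theorem f₂_eq_iff (p : P lam .M) (x : P lam .R) (u v : P lam .M) : f₂ lam p = (x, u, v) ↔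
    c lam * (p : Alg lam) = x ∧ a lam * (p : Alg lam) = u ∧ b lam * (p : Alg lam) = v := by
  simp only [Prod.ext_iff, Subtype.ext_iff]
  rfl

theorem f₁_eq_iff (x x' : P lam .R) (u v u' v' : P lam .M) : f₁ lam (x, u, v) = (x', u', v') ↔
    c lam * d lam * x + c lam * b lam * v = x' ∧ b lam * (u : Alg lam) + a lam * v = u' ∧
      b lam * d lam * x + (a lam * u + (d lam * c lam + lam • b lam + b lam ^ 2) * v) = v' := by
  simp [f₁, coe_mulMap, Subtype.ext_iff]

theorem coe_f₀ (x : P lam .R) (u v : P lam .M) :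
    (f₀ lam (x, u, v) : Alg lam) = d lam * x + (a lam * u + b lam * v) := rfl

theorem d_mul_c_add_smul_b_add_b_sq_mul (x : Alg lam) :
    (d lam * c lam + lam • b lam + b lam ^ 2) * x = d lam * c lam * x
      + algebraMap ℂ (Alg lam) lam * (b lam * x) + b lam * b lam * x := by
  rw [add_mul, add_mul, Algebra.smul_def, mul_assoc (algebraMap _ _ _), pow_two]

theorem f₁_f₂_apply (p : P lam .M) : f₁ lam (f₂ lam p) = 0 := by
  refine (f₁_eq_iff _ 0 _ _ 0 0).2 ⟨?_, ?_, ?_⟩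
  all_goals simp only [coe_mulMap, Submodule.coe_zero, d_mul_c_add_smul_b_add_b_sq_mul]
  · linear_combination (norm := noncomm_ring) relation_c lam * p
  · linear_combination (norm := noncomm_ring) relation_ab lam * p
  · linear_combination (norm := noncomm_ring) relation_a_sq lam * p

theorem f₀_f₁_apply (q : P lam .R × P lam .M × P lam .M) : f₀ lam (f₁ lam q) = 0 := by
  obtain ⟨x, u, v⟩ := q
  obtain ⟨h₁, h₂, h₃⟩ := (f₁_eq_iff x _ u v _ _).1 rfl
  refine Subtype.ext ((coe_f₀ _ _ _).trans ?_)
  rw [← h₁, ← h₂, ← h₃, d_mul_c_add_smul_b_add_b_sq_mul, Submodule.coe_zero]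
  linear_combination (norm := noncomm_ring) relation_d lam * x + relation_ab lam * u
    + relation_a_sq lam * v - (Algebra.commutes lam (b lam)) * (b lam * v)

theorem exists_of_b_mul_add_a_mul_eq_zero (u v : P lam .M)
    (h : b lam * (u : Alg lam) + a lam * v = 0) :
    ∃ p : P lam .M, (u : Alg lam) = a lam * p ∧ (v : Alg lam) = b lam * p := by
  have hav : a lam * (v : Alg lam) = b lam * -(u : Alg lam) := by
    rw [mul_neg]
    exact eq_neg_of_add_eq_zero_right h
  obtain ⟨p, hp⟩ := exists_b_mul_of_a_mul (e_mul_coe v) hav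
  have hv : (v : Alg lam) = b lam * (e lam .M * p) := by rw [← mul_assoc, b_mul_e, hp]
  refine ⟨⟨e lam .M * p, e_mul_mem_P .M p⟩, ?_, hv⟩
  refine b_mul_cancel (e_mul_coe u) (by rw [← mul_assoc, e_mul_a]) ?_
  rw [hv] at h
  linear_combination (norm := noncomm_ring) h - relation_ab lam * (e lam .M * p)

variable (lam) in
theorem exact_f₂_f₁ : Function.Exact (f₂ lam) (f₁ lam) := by
  rintro ⟨x, u, v⟩
  refine ⟨fun h => ?_, fun ⟨p, hp⟩ => hp ▸ f₁_f₂_apply p⟩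
  obtain ⟨-, h₂, h₃⟩ := (f₁_eq_iff x 0 u v 0 0).1 h
  obtain ⟨p, hu, hv⟩ := exists_of_b_mul_add_a_mul_eq_zero u v h₂
  have hdx : d lam * (x : Alg lam) = d lam * (c lam * p) := by
    refine b_mul_cancel (by rw [← mul_assoc, e_mul_d]) (by rw [← mul_assoc, e_mul_d]) ?_
    rw [hu, hv, d_mul_c_add_smul_b_add_b_sq_mul, Submodule.coe_zero] at h₃
    linear_combination (norm := noncomm_ring) h₃ - relation_a_sq lam * p
  have hx : (x : Alg lam) = c lam * p :=
    d_mul_cancel (e_mul_coe x) (by rw [← mul_assoc, e_mul_c]) hdx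
  exact ⟨p, (f₂_eq_iff p x u v).2 ⟨hx.symm, hu.symm, hv.symm⟩⟩

theorem exists_f₁_fst_eq {x : P lam .R} {u v : P lam .M} (h : f₀ lam (x, u, v) = 0) :
    ∃ s, (f₁ lam s).1 = x := by
  have hd : d lam * (x : Alg lam) = a lam * -(u : Alg lam) + b lam * -(v : Alg lam) := by
    rw [← Submodule.coe_eq_zero, coe_f₀] at h
    linear_combination (norm := noncomm_ring) h
  obtain ⟨r, s, hrs⟩ := exists_c_mul_of_d_mul (e_mul_coe x) hd
  refine ⟨(⟨e lam .R * r, e_mul_mem_P .R r⟩, 0, ⟨e lam .M * s, e_mul_mem_P .M s⟩),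
    Subtype.ext ?_⟩
  refine ((f₁_eq_iff _ _ _ _ _ _).1 rfl).1.symm.trans ?_
  rw [hrs, ← mul_assoc, ← mul_assoc, mul_assoc _ (d lam), mul_assoc _ (b lam), d_mul_e, b_mul_e]

theorem exists_f₁_eq_of_fst_eq_zero {u v : P lam .M} (h : f₀ lam (0, u, v) = 0) :
    ∃ t, f₁ lam t = (0, u, v) := by
  have h' : b lam * (v : Alg lam) + a lam * u = 0 := by
    rwa [← Submodule.coe_eq_zero, coe_f₀, Submodule.coe_zero, mul_zero, zero_add, add_comm] at h
  obtain ⟨p, hv, hu⟩ := exists_of_b_mul_add_a_mul_eq_zero v u h'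
  exact ⟨(0, p, 0), (f₁_eq_iff _ _ _ _ _ _).2 (by simp [hu, hv])⟩

variable (lam) in
theorem exact_f₁_f₀ : Function.Exact (f₁ lam) (f₀ lam) := by
  rintro ⟨x, u, v⟩
  refine ⟨fun h => ?_, fun ⟨q, hq⟩ => hq ▸ f₀_f₁_apply q⟩
  obtain ⟨s, rfl⟩ := exists_f₁_fst_eq h
  obtain ⟨t, ht⟩ : ∃ t, f₁ lam t = (0, u - (f₁ lam s).2.1, v - (f₁ lam s).2.2) := by
    refine exists_f₁_eq_of_fst_eq_zero ?_
    rw [← sub_self (f₁ lam s).1]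
    exact (map_sub (f₀ lam) (_, u, v) (f₁ lam s)).trans (by rw [h, f₀_f₁_apply, sub_self])
  refine ⟨s + t, ?_⟩
  rw [map_add, ht]
  exact Prod.ext (add_zero _) (Prod.ext (add_sub_cancel _ _) (add_sub_cancel _ _))

theorem character_e_self (v : Vertex) : character lam v (e lam v) = 1 :=
  (RingQuot.liftAlgHom_mkAlgHom_apply _ _ _ _).trans (PathAlgebra.coeffIdem_idem v)

theorem character_e_of_ne {v w : Vertex} (h : w ≠ v) : character lam v (e lam w) = 0 :=
  (RingQuot.liftAlgHom_mkAlgHom_apply _ _ _ _).trans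
    (PathAlgebra.coeffIdem_ofPath_of_ne fun h' => h (congrArg QuiverPath.src h'))

theorem character_arrow (v : Vertex) {i j : Vertex} (f : Arrow i j) :
    character lam v (RingQuot.mkAlgHom ℂ (Rel lam) (arrow f)) = 0 :=
  (RingQuot.liftAlgHom_mkAlgHom_apply _ _ _ _).trans
    (PathAlgebra.coeffIdem_ofArrow (V := Vertex) v f)

section Character

variable (lam) (v : Vertex)

theorem character_a : character lam v (a lam) = 0 := character_arrow v .a

theorem character_b : character lam v (b lam) = 0 := character_arrow v .b

theorem character_c : character lam v (c lam) = 0 := character_arrow v .c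

theorem character_d : character lam v (d lam) = 0 := character_arrow v .d

end Character

theorem exists_e_M_mul_eq (x : Alg lam) : ∃ r u v, e lam .M * x
    = character lam .M x • e lam .M + (d lam * r + (a lam * u + b lam * v)) := by
  induction x using Alg.induction with
  | add x y hx hy =>
    obtain ⟨r, u, v, hx⟩ := hx
    obtain ⟨r', u', v', hy⟩ := hy
    refine ⟨r + r', u + u', v + v', ?_⟩
    rw [mul_add, hx, hy, map_add, add_smul]
    simp only [mul_add]
    abel
  | smul t x hx =>
    obtain ⟨r, u, v, hx⟩ := hx
    refine ⟨t • r, t • u, t • v, ?_⟩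
    rw [mul_smul_comm, hx, map_smul, smul_assoc]
    simp only [smul_add, mul_smul_comm]
  | idem i =>
    refine ⟨0, 0, 0, ?_⟩
    cases i with
    | M => simp [character_e_self, e_mul_e_self]
    | R => simp [character_e_of_ne, e_mul_e_of_ne]
  | a_mul x => exact ⟨0, x, 0, by simp [character_a, ← mul_assoc, e_mul_a]⟩
  | b_mul x => exact ⟨0, 0, x, by simp [character_b, ← mul_assoc, e_mul_b]⟩
  | c_mul x =>
    refine ⟨0, 0, 0, ?_⟩
    rw [← mul_assoc, mul_eq_zero_of_ne (e_mul_e_self lam .M) (e_mul_c lam) (by decide)]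
    simp [character_c]
  | d_mul x => exact ⟨x, 0, 0, by simp [character_d, ← mul_assoc, e_mul_d]⟩

variable (lam) in
theorem exact_f₀_augmentation : Function.Exact (f₀ lam) (augmentation lam .M) := by
  refine fun y => ⟨fun hy => ?_, ?_⟩
  · replace hy : character lam .M (y : Alg lam) = 0 := hy
    obtain ⟨r, u, v, h⟩ := exists_e_M_mul_eq (y : Alg lam)
    rw [hy, zero_smul, zero_add, e_mul_coe] at h
    refine ⟨(⟨e lam .R * r, e_mul_mem_P .R r⟩, ⟨e lam .M * u, e_mul_mem_P .M u⟩,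
      ⟨e lam .M * v, e_mul_mem_P .M v⟩), Subtype.ext ((coe_f₀ _ _ _).trans ?_)⟩
    simp only [h, ← mul_assoc, d_mul_e, a_mul_e, b_mul_e]
  · rintro ⟨⟨x, u, v⟩, rfl⟩
    change character lam .M (f₀ lam (x, u, v)) = 0
    simp [coe_f₀, character_a, character_b, character_d]

variable (lam) in
theorem augmentation_surjective (v : Vertex) : Function.Surjective (augmentation lam v) := by
  intro (r : ℂ)
  refine ⟨⟨r • e lam v, mem_P_iff.2 (by rw [mul_smul_comm, e_mul_e_self])⟩, ?_⟩
  change character lam v (r • e lam v) = r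
  rw [map_smul, character_e_self, smul_eq_mul, mul_one]

end Resolution

end MorrisonPinkham

end

open MorrisonPinkham in
theorem theorem4 (lam : ℂ) :
    (Module.Projective (Alg lam)ᵐᵒᵖ (P lam .R) ∧ Module.Projective (Alg lam)ᵐᵒᵖ (P lam .M)) ∧
    Function.Injective (f₂ lam) ∧
    Function.Exact (f₂ lam) (f₁ lam) ∧
    Function.Exact (f₁ lam) (f₀ lam) ∧
    Function.Exact (f₀ lam) (augmentation lam .M) ∧
    Function.Surjective (augmentation lam .M) ∧
    Function.Injective (mulMap lam .M .M (b lam) (e_mul_b lam)) :=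
  ⟨⟨projective_P lam .R, projective_P lam .M⟩, f₂_injective lam, exact_f₂_f₁ lam, exact_f₁_f₀ lam,
    exact_f₀_augmentation lam, augmentation_surjective lam .M, mulMap_b_injective lam⟩
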